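/- **Theorem 3.2.** A probability distribution over $[-1,1)$ is called *$t$-piecewise degree-$d$* if it has a density $f$ on $[-1,1)$ for which there are a partition of $[-1,1)$ into $t$ disjoint intervals $I_1,\dots,I_t$ and real polynomials $q_1,\dots,q_t$ of degree at most $d$ with $f=q_j$ on $I_j$ for every $j$. Let $d_{\mathrm{TV}}(p,h)=\sup_A|p(A)-h(A)|$, the supremum over measurable sets $A$, denote the total variation distance. There are absolute constants $c>0$ and $\varepsilon_0>0$ such that the following holds for all integers $t\ge 1$, $d\ge 0$ with $t+d>1$ and all $0<\varepsilon\le\varepsilon_0$. Let $L$ be any (possibly randomized) algorithm, which may depend on $t,d,\varepsilon$, that draws $n$ independent samples from an unknown distribution $p$ and outputs a hypothesis probability distribution $h$, and suppose that for every $t$-piecewise degree-$d$ distribution $p$ over $[-1,1)$ $$\mathbb{E}[d_{\mathrm{TV}}(p,h)]\le\varepsilon,$$ where the expectation is over the samples drawn from $p$ and the internal randomness of $L$. Then $$n\;\ge\; c\cdot\frac{t(d+1)}{(1+\log(d+1))^2}\cdot\frac1{\varepsilon^2}.$$ -/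

import Mathlib

open MeasureTheory ProbabilityTheory Set

/-- `f` is `t`-piecewise degree-`d` on `[-1,1)`: there is a partition of `[-1,1)` into `t` disjoint
intervals `I j`, on each of which `f` coincides with a real polynomial of degree at most `d`.
(Intervals are order-connected sets, of any endpoint type; an empty `I j` is harmless, since a
nondegenerate interval of the partition can be split further.) -/
def IsPiecewisePolynomial (t d : ℕ) (f : ℝ → ℝ) : Prop :=
  ∃ (I : Fin t → Set ℝ) (q : Fin t → Polynomial ℝ),
    (∀ j, (I j).OrdConnected) ∧
    (∀ i j, i ≠ j → Disjoint (I i) (I j)) ∧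
    (⋃ j, I j) = Ico (-1 : ℝ) 1 ∧
    (∀ j, (q j).natDegree ≤ d) ∧
    (∀ j, ∀ x ∈ I j, f x = (q j).eval x)

/-- `p` is a `t`-piecewise degree-`d` distribution over `[-1,1)`: a probability measure carried by
`[-1,1)` with a nonnegative `t`-piecewise degree-`d` density with respect to Lebesgue measure. -/
def IsPiecewisePolynomialDistribution (t d : ℕ) (p : Measure ℝ) : Prop :=
  IsProbabilityMeasure p ∧
  ∃ f : ℝ → ℝ, IsPiecewisePolynomial t d f ∧ (∀ x ∈ Ico (-1 : ℝ) 1, 0 ≤ f x) ∧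
    p = (volume.restrict (Ico (-1 : ℝ) 1)).withDensity (fun x => ENNReal.ofReal (f x))

/-- Total variation distance `sup_A |p(A) - q(A)|` (`A` measurable) of two probability measures;
it equals `(1/2) ∫ |p(x) - q(x)| dx` when `p` and `q` have densities. -/
noncomputable def totalVariationDist (p q : Measure ℝ) : ℝ :=
  ⨆ A : {A : Set ℝ // MeasurableSet A}, |p.real A - q.real A|

universe u

/-- A randomized (not necessarily efficient) learning algorithm that draws `n` samples.
It has a random seed with law `seedLaw` (its internal randomness); from the seed and
the `n` samples it computes a hypothesis distribution, depending measurably on them. A run may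
ignore some samples, so `n` is a worst-case bound on the number of samples that are used. -/
structure LearningAlgorithm (n : ℕ) where
  /-- The set of seeds. -/
  Seed : Type u
  /-- The σ-algebra on the seeds. -/
  seedMeasurableSpace : MeasurableSpace Seed
  /-- The law of the seed. -/
  seedLaw : Measure Seed
  /-- The seed is a random variable. -/
  seedLaw_prob : IsProbabilityMeasure seedLaw
  /-- The hypothesis computed from the seed and the samples. -/
  hypothesis : Kernel (Seed × (Fin n → ℝ)) ℝ
  /-- Every hypothesis is a probability distribution. -/
  hypothesis_prob : IsMarkovKernel hypothesis

attribute [instance] LearningAlgorithm.seedMeasurableSpace LearningAlgorithm.seedLaw_prob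
  LearningAlgorithm.hypothesis_prob

/-- `E[d_TV(p, h)]`, where `h` is the output of `L` on independent samples from `p`; the expectation
is over the samples and over the seed, which is independent of them. -/
noncomputable def LearningAlgorithm.expectedError {n : ℕ} (L : LearningAlgorithm.{u} n)
    (p : Measure ℝ) : ENNReal :=
  ∫⁻ ω, ENNReal.ofReal (totalVariationDist p (L.hypothesis ω))
    ∂(L.seedLaw.prod (Measure.pi (fun _ : Fin n => p)))

/-- `L` learns all `t`-piecewise degree-`d` distributions over `[-1,1)` to expected total variation
distance at most `ε`. -/
def LearningAlgorithm.Learns {n : ℕ} (L : LearningAlgorithm.{u} n) (t d : ℕ) (ε : ℝ) : Prop :=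
  ∀ p : Measure ℝ, IsPiecewisePolynomialDistribution t d p →
    L.expectedError p ≤ ENNReal.ofReal ε

/-! The bound comes from Assouad's lemma applied to a hypercube of densities `1/2 + δ ∑ ± φ i` with
`K ≈ t (d + 1)` perturbations and `δ ≈ ε`. Each `φ i` has mean zero, has L¹ norm of order `1/K`, and
puts a dominant share of order `1/K` of its mass on its own test set. Flipping one sign changes the
chi-square divergence by `O(δ² / K)`, so `n ≲ K / δ²` samples cannot determine that sign. Diagonal
dominance of the masses on test sets makes total variation at least of order `δ / K` times Hamming
distance (`exists_finset_le_abs_sum`). An algorithm wrong on a constant fraction of the signs thus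
has error of order `δ`, which exceeds `ε` for a suitable multiple
(`SeparatedFamily.half_lt_of_learns`).

Perturbations are built on one interval and copied to equal subintervals
(`SeparatedFamily.replicate`). For large `d`, about `d / 280` of them fit on one interval:
translates of the squared Chebyshev quotient `(T_m(u) / (m u))²`, made odd to have mean zero. Its
inverse-square decay keeps the interaction between cells summable, with no logarithmic loss. The
argument therefore gives order `t (d + 1) / ε²`, and the logarithm in the statement is simply
discarded. -/

/-! ### Likelihood ratios of product measures and two-point testing. -/

theorem lintegral_pi_prod_eq_prod {n : ℕ} {α : Type*} [MeasurableSpace α] (Q : Measure α)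
    [IsProbabilityMeasure Q] (f : Fin n → α → ENNReal) (hf : ∀ i, Measurable (f i)) :
    ∫⁻ x, ∏ i, f i (x i) ∂(Measure.pi fun _ : Fin n => Q) = ∏ i, ∫⁻ y, f i y ∂Q := by
  have h := lintegral_prod_eq_prod_lintegral_of_indepFun (μ := Measure.pi fun _ : Fin n => Q)
    (s := Finset.univ) (fun i x => f i (x i))
    (iIndepFun_pi (μ := fun _ : Fin n => Q) (X := f) (fun i => (hf i).aemeasurable))
    (fun i => (hf i).comp (measurable_pi_apply i))
  rw [h]
  refine Finset.prod_congr rfl fun i _ => ?_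
  exact (measurePreserving_eval (fun _ : Fin n => Q) i).lintegral_comp (hf i)

theorem pi_withDensity_eq {n : ℕ} {α : Type*} [MeasurableSpace α] (Q : Measure α)
    [IsProbabilityMeasure Q] {L : α → ENNReal} (hL : Measurable L)
    [SigmaFinite (Q.withDensity L)] :
    Measure.pi (fun _ : Fin n => Q.withDensity L) =
      (Measure.pi fun _ : Fin n => Q).withDensity (fun x => ∏ i, L (x i)) := by
  refine Measure.pi_eq fun s hs => ?_
  rw [withDensity_apply _ (MeasurableSet.univ_pi hs), ← lintegral_indicator (MeasurableSet.univ_pi hs)]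
  have : ∀ x : Fin n → α, (Set.pi univ s).indicator (fun x => ∏ i, L (x i)) x =
      ∏ i, (s i).indicator L (x i) := by
    intro x
    by_cases hx : x ∈ Set.pi univ s
    · rw [indicator_of_mem hx]
      exact Finset.prod_congr rfl fun i _ => (indicator_of_mem (hx i (mem_univ i)) _).symm
    · rw [indicator_of_notMem hx]
      simp only [Set.mem_pi, mem_univ, true_implies, not_forall] at hx
      obtain ⟨i, hi⟩ := hx
      exact (Finset.prod_eq_zero (Finset.mem_univ i) (indicator_of_notMem hi _)).symm
  simp_rw [this]
  rw [lintegral_pi_prod_eq_prod Q _ (fun i => hL.indicator (hs i))]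
  refine Finset.prod_congr rfl fun i _ => ?_
  rw [lintegral_indicator (hs i), withDensity_apply _ (hs i)]

/-- Bounds a likelihood ratio by its square. The weight 1/4 turns a second moment of at most 2 into
an additive 1/2, which stays below 1. -/
theorem ENNReal.le_four_add_sq (G : ENNReal) : G ≤ 4 + 4⁻¹ * G ^ 2 := by
  rcases le_total G 4 with h | h
  · exact h.trans le_self_add
  · calc G = 4⁻¹ * 4 * G := by
          rw [ENNReal.inv_mul_cancel (by norm_num) (by norm_num), one_mul]
      _ ≤ 4⁻¹ * G * G := by gcongr
      _ = 4⁻¹ * G ^ 2 := by ring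
      _ ≤ _ := le_add_self

/-- A change of measure between product measures with bounded second moment of the likelihood
ratio. -/
theorem prod_pi_withDensity_apply_le {n : ℕ} {α Ω : Type*} [MeasurableSpace α] [MeasurableSpace Ω]
    (μ : Measure Ω) [IsProbabilityMeasure μ] (Q : Measure α)
    [IsProbabilityMeasure Q] {L : α → ENNReal} (hL : Measurable L)
    [IsProbabilityMeasure (Q.withDensity L)] (h2 : (∫⁻ x, L x ^ 2 ∂Q) ^ n ≤ 2)
    {E : Set (Ω × (Fin n → α))} (hE : MeasurableSet E) :
    (μ.prod (Measure.pi fun _ : Fin n => Q.withDensity L)) E ≤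
      4 * (μ.prod (Measure.pi fun _ : Fin n => Q)) E + 2⁻¹ := by
  set G : (Fin n → α) → ENNReal := fun x => ∏ i, L (x i) with hG
  have hGm : Measurable G := by fun_prop
  have hpi := pi_withDensity_eq (n := n) Q hL
  have : SFinite ((Measure.pi fun _ : Fin n => Q).withDensity G) := by
    rw [← hpi]; infer_instance
  have hsq : ∫⁻ x, G x ^ 2 ∂(Measure.pi fun _ : Fin n => Q) ≤ 2 := by
    have := lintegral_pi_prod_eq_prod (n := n) Q (fun _ x => L x ^ 2) (fun _ => hL.pow_const 2)
    simp only [Finset.prod_const, Finset.card_univ, Fintype.card_fin] at this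
    simp only [hG, ← Finset.prod_pow]
    rw [this]; exact h2
  rw [hpi, prod_withDensity_right hGm, withDensity_apply _ hE]
  calc ∫⁻ a in E, G a.2 ∂(μ.prod (Measure.pi fun _ : Fin n => Q))
      ≤ ∫⁻ a in E, (4 + 4⁻¹ * G a.2 ^ 2) ∂(μ.prod (Measure.pi fun _ : Fin n => Q)) :=
        lintegral_mono fun a => ENNReal.le_four_add_sq _
    _ = 4 * (μ.prod (Measure.pi fun _ : Fin n => Q)) E +
          4⁻¹ * ∫⁻ a in E, G a.2 ^ 2 ∂(μ.prod (Measure.pi fun _ : Fin n => Q)) := by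
        rw [lintegral_add_left measurable_const, setLIntegral_const, lintegral_const_mul]
        exact (hGm.comp measurable_snd).pow_const 2
    _ ≤ 4 * (μ.prod (Measure.pi fun _ : Fin n => Q)) E +
          4⁻¹ * ∫⁻ a, G a.2 ^ 2 ∂(μ.prod (Measure.pi fun _ : Fin n => Q)) := by
        gcongr; exact Measure.restrict_le_self
    _ ≤ 4 * (μ.prod (Measure.pi fun _ : Fin n => Q)) E + 4⁻¹ * 2 := by
        gcongr
        refine le_trans (le_of_eq ?_) hsq
        exact (measurePreserving_snd (μ := μ) (ν := Measure.pi fun _ : Fin n => Q)).lintegral_comp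
          (hGm.pow_const 2)
    _ = _ := by
        congr 1
        rw [show (4 : ENNReal) = 2 * 2 by norm_num, ENNReal.mul_inv (by simp) (by simp), mul_assoc,
          ENNReal.inv_mul_cancel (by simp) (by simp), mul_one]

/-- Changing measure on `Eᶜ` gives `1 - P(E) ≤ 4 Q(Eᶜ) + 1/2`, hence `1/2 ≤ 4 (P(E) + Q(Eᶜ))`: no
test has both errors small. -/
theorem one_eighth_le_errors {n : ℕ} {α Ω : Type*} [MeasurableSpace α] [MeasurableSpace Ω]
    (μ : Measure Ω) [IsProbabilityMeasure μ] (Q : Measure α)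
    [IsProbabilityMeasure Q] {L : α → ENNReal} (hL : Measurable L)
    [IsProbabilityMeasure (Q.withDensity L)] (h2 : (∫⁻ x, L x ^ 2 ∂Q) ^ n ≤ 2)
    {E : Set (Ω × (Fin n → α))} (hE : MeasurableSet E) :
    1 / 8 ≤ (μ.prod (Measure.pi fun _ : Fin n => Q.withDensity L)).real E +
      (μ.prod (Measure.pi fun _ : Fin n => Q)).real Eᶜ := by
  have h := prod_pi_withDensity_apply_le μ Q hL h2 hE.compl
  have h' := ENNReal.toReal_mono (by finiteness) h
  rw [ENNReal.toReal_add (by finiteness) (by simp), ENNReal.toReal_mul] at h'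
  change (μ.prod (Measure.pi fun _ : Fin n => Q.withDensity L)).real Eᶜ ≤
    _ * (μ.prod (Measure.pi fun _ : Fin n => Q)).real Eᶜ + _ at h'
  rw [probReal_compl_eq_one_sub hE] at h'
  have h0 : 0 ≤ (μ.prod (Measure.pi fun _ : Fin n => Q)).real Eᶜ := measureReal_nonneg
  have h0' : 0 ≤ (μ.prod (Measure.pi fun _ : Fin n => Q.withDensity L)).real E := measureReal_nonneg
  norm_num at h'
  linarith

/-! ### Assouad's lemma. -/

theorem abs_sub_le_totalVariationDist (p q : Measure ℝ) [IsProbabilityMeasure p]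
    [IsProbabilityMeasure q] {A : Set ℝ} (hA : MeasurableSet A) :
    |p.real A - q.real A| ≤ totalVariationDist p q := by
  refine le_ciSup (f := fun A : {A : Set ℝ // MeasurableSet A} => |p.real A - q.real A|) ?_ ⟨A, hA⟩
  refine ⟨1, ?_⟩
  rintro _ ⟨B, rfl⟩
  have h1 : p.real B ≤ 1 := measureReal_le_one
  have h2 : q.real B ≤ 1 := measureReal_le_one
  have h3 : 0 ≤ p.real B := measureReal_nonneg
  have h4 : 0 ≤ q.real B := measureReal_nonneg
  exact abs_sub_le_iff.2 ⟨by linarith, by linarith⟩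

/-- The table of pairwise comparisons takes finitely many values and depends measurably on `ω`, so
any choice of minimizer made from the table alone is measurable. -/
theorem exists_measurable_argmin {Ω β : Type*} [MeasurableSpace Ω] [MeasurableSpace β]
    [DiscreteMeasurableSpace β] [Finite β] [Nonempty β] (D : β → Ω → ℝ)
    (hD : ∀ b, Measurable (D b)) :
    ∃ g : Ω → β, Measurable g ∧ ∀ ω b, D (g ω) ω ≤ D b ω := by
  classical
  let R : Ω → β → β → Prop := fun ω b b' => D b ω ≤ D b' ω
  have hR : Measurable R := by
    refine measurable_pi_lambda _ fun b => measurable_pi_lambda _ fun b' => ?_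
    exact measurableSet_setOfPred.1 (measurableSet_le (hD b) (hD b'))
  let sel : (β → β → Prop) → β := fun r =>
    if h : ∃ b, ∀ b', r b b' then h.choose else Classical.arbitrary β
  refine ⟨fun ω => sel (R ω), (measurable_of_finite sel).comp hR, fun ω b => ?_⟩
  have h : ∃ b, ∀ b', R ω b b' := Finite.exists_min fun b => D b ω
  have : sel (R ω) = h.choose := dif_pos h
  change D (sel (R ω)) ω ≤ D b ω
  rw [this]
  exact h.choose_spec b

/-- Assouad's lemma: if the hypercube of distributions `p b` is separated on finitely many test sets
proportionally to the Hamming distance, and no test distinguishes neighbouring vertices,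
then the dimension of the cube bounds the expected error of every algorithm from below. -/
theorem assouad {ι : Type} [Fintype ι] [DecidableEq ι] {n : ℕ} (L : LearningAlgorithm.{u} n)
    (p : (ι → Bool) → Measure ℝ) (hp : ∀ b, IsProbabilityMeasure (p b))
    {T : Type} [Finite T] [Nonempty T] (A : T → Set ℝ) (hA : ∀ B, MeasurableSet (A B)) {α ε : ℝ}
    (hα : 0 ≤ α) (hε : 0 ≤ ε)
    (hsep : ∀ b b', ∃ B, α * (hammingDist b b' : ℝ) ≤ |(p b).real (A B) - (p b').real (A B)|)
    (hnb : ∀ b j, ∀ E : Set (L.Seed × (Fin n → ℝ)), MeasurableSet E →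
      1 / 8 ≤ (L.seedLaw.prod (Measure.pi fun _ : Fin n => p b)).real E +
        (L.seedLaw.prod (Measure.pi fun _ : Fin n => p (Function.update b j (!b j)))).real Eᶜ)
    (hL : ∀ b, L.expectedError (p b) ≤ ENNReal.ofReal ε) :
    α * Fintype.card ι ≤ 32 * ε := by
  -- A finite supremum replaces total variation: it is measurable in `ω`, bounds total variation
  -- from below, and is all that the separation hypothesis needs.
  let D : (ι → Bool) → L.Seed × (Fin n → ℝ) → ℝ := fun b ω =>
    ⨆ B, |(p b).real (A B) - (L.hypothesis ω).real (A B)|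
  have hle : ∀ b ω B, |(p b).real (A B) - (L.hypothesis ω).real (A B)| ≤ D b ω := fun b ω B =>
    le_ciSup (f := fun B => |(p b).real (A B) - (L.hypothesis ω).real (A B)|)
      (Set.finite_range _).bddAbove B
  have hDm : ∀ b, Measurable (D b) := by
    intro b
    refine Measurable.iSup fun B => ?_
    have : Measurable fun ω => (L.hypothesis ω).real (A B) :=
      (L.hypothesis.measurable_coe (hA B)).ennreal_toReal
    exact (measurable_const.sub this).abs
  have hDTV : ∀ b ω, D b ω ≤ totalVariationDist (p b) (L.hypothesis ω) := fun b ω =>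
    ciSup_le fun B => abs_sub_le_totalVariationDist _ _ (hA B)
  obtain ⟨g, hg, hmin⟩ := exists_measurable_argmin D hDm
  let E : (ι → Bool) → ι → Set (L.Seed × (Fin n → ℝ)) := fun b j => {ω | g ω j ≠ b j}
  have hE : ∀ b j, MeasurableSet (E b j) := fun b j =>
    hg (MeasurableSet.of_discrete (s := {c : ι → Bool | c j ≠ b j}))
  let P : (ι → Bool) → Measure (L.Seed × (Fin n → ℝ)) := fun b =>
    L.seedLaw.prod (Measure.pi fun _ : Fin n => p b)
  have hPprob : ∀ b, IsProbabilityMeasure (P b) := fun b => by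
    have := hp b; infer_instance
  have hham : ∀ b ω, (hammingDist b (g ω) : ℝ) = ∑ j, (E b j).indicator (fun _ => (1 : ℝ)) ω := by
    intro b ω
    simp only [hammingDist, Finset.card_filter, Nat.cast_sum, Nat.cast_ite, Nat.cast_one,
      Nat.cast_zero, Set.indicator_apply]
    refine Finset.sum_congr rfl fun j _ => ?_
    simp only [E, mem_ofPred_eq, ne_comm]
  have hint : ∀ b, Integrable (fun ω => (hammingDist b (g ω) : ℝ)) (P b) := by
    intro b
    simp_rw [hham]
    exact integrable_finsetSum _ fun j _ => (integrable_const _).indicator (hE b j)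
  have hbound : ∀ b, α * ∑ j, (P b).real (E b j) ≤ 2 * ε := by
    intro b
    have h1 : ∫⁻ ω, ENNReal.ofReal (α / 2 * hammingDist b (g ω)) ∂(P b) ≤ ENNReal.ofReal ε := by
      refine le_trans (lintegral_mono fun ω => ENNReal.ofReal_le_ofReal ?_) (hL b)
      refine le_trans ?_ (hDTV b ω)
      -- Since `g ω` minimizes `D`, the triangle inequality gives `α * hammingDist ≤ D b + D (g ω) ≤
      -- 2 * D b`.
      obtain ⟨B, hB⟩ := hsep b (g ω)
      have h2 := abs_sub_le ((p b).real (A B)) ((L.hypothesis ω).real (A B))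
        ((p (g ω)).real (A B))
      rw [abs_sub_comm ((L.hypothesis ω).real (A B))] at h2
      linarith [hle b ω B, hle (g ω) ω B, hmin ω b]
    rw [← ofReal_integral_eq_lintegral_ofReal ((hint b).const_mul _)
      (Filter.Eventually.of_forall fun ω => by positivity),
      ENNReal.ofReal_le_ofReal_iff hε, integral_const_mul] at h1
    simp_rw [hham] at h1
    rw [integral_finsetSum _ fun j _ => (integrable_const _).indicator (hE b j)] at h1
    simp_rw [integral_indicator_const _ (hE b _), smul_eq_mul, mul_one] at h1
    linarith
  -- Flipping bit `j` permutes the cube and complements the error event at `j`, so averaging over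
  -- vertices pairs up the two errors of each neighbouring test.
  have hflip : ∀ j, ∑ b, (P b).real (E b j) =
      ∑ b, (P (Function.update b j (!b j))).real (E b j)ᶜ := by
    intro j
    have hinv : Function.Involutive fun b : ι → Bool => Function.update b j (!b j) := by
      intro b; simp
    rw [← Equiv.sum_comp (hinv.toPerm _) fun b => (P b).real (E b j)]
    refine Finset.sum_congr rfl fun b _ => ?_
    simp only [Function.Involutive.coe_toPerm]
    congr 1
    ext ω
    simp only [E, mem_ofPred_eq, mem_compl_iff, Function.update_self]
    cases g ω j <;> cases b j <;> simp
  have hlow : ∀ j, (Fintype.card (ι → Bool) : ℝ) / 16 ≤ ∑ b, (P b).real (E b j) := by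
    intro j
    have h1 : ∑ b : ι → Bool, (1 / 8 : ℝ) ≤
        ∑ b, ((P b).real (E b j) + (P (Function.update b j (!b j))).real (E b j)ᶜ) :=
      Finset.sum_le_sum fun b _ => hnb b j _ (hE b j)
    rw [Finset.sum_add_distrib, ← hflip j, Finset.sum_const, nsmul_eq_mul, Finset.card_univ] at h1
    linarith
  set N : ℝ := (Fintype.card (ι → Bool) : ℝ)
  have hN : 0 < N := by positivity
  have h1 : α * ∑ j, ∑ b, (P b).real (E b j) ≤ N * (2 * ε) := by
    rw [Finset.sum_comm, Finset.mul_sum]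
    refine (Finset.sum_le_sum fun b _ => hbound b).trans ?_
    simp [N]
  have h2 : (Fintype.card ι : ℝ) * (N / 16) ≤ ∑ j, ∑ b, (P b).real (E b j) := by
    have := Finset.sum_le_sum fun j (_ : j ∈ Finset.univ) => hlow j
    simpa [N] using this
  have h3 := (mul_le_mul_of_nonneg_left h2 hα).trans h1
  have h4 : N * (α * Fintype.card ι) ≤ N * (32 * ε) := by nlinarith
  exact le_of_mul_le_mul_left h4 hN

/-! ### Hypercubes of densities spanned by separated perturbations. -/

/-- The sign `±1` encoded by a bit. -/
def bitSign (b : Bool) : ℝ := if b then 1 else -1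

theorem abs_bitSign (b : Bool) : |bitSign b| = 1 := by cases b <;> simp [bitSign]

/-- Finitely many mean-zero perturbations `φ i` on `[-1,1)` of bounded total size, each concentrated
on its own test set `S i`, all of whose linear combinations are piecewise polynomial. -/
structure SeparatedFamily {ι : Type} [Fintype ι] [DecidableEq ι] (t d : ℕ) (φ : ι → ℝ → ℝ)
    (S : ι → Set ℝ) (β γ : ℝ) : Prop where
  measurable : ∀ i, Measurable (φ i)
  measurableSet : ∀ i, MeasurableSet (S i)
  eq_zero : ∀ i x, x ∉ Ico (-1 : ℝ) 1 → φ i x = 0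
  sum_abs_le : ∀ x, ∑ i, |φ i x| ≤ 2
  integral_eq_zero : ∀ i, ∫ x, φ i x = 0
  subset : ∀ i, S i ⊆ Ico (-1 : ℝ) 1
  disjoint : Pairwise fun i j => Disjoint (S i) (S j)
  dominant : ∀ j, β + ∑ i ∈ Finset.univ.erase j, ∫ x in S i, |φ j x| ≤ ∫ x in S j, φ j x
  integral_abs_le : ∀ i, ∫ x, |φ i x| ≤ γ
  piecewise : ∀ (c : ℝ) (a : ι → ℝ), IsPiecewisePolynomial t d fun x => c + ∑ i, a i * φ i x

/-- With `c` the sign difference, entries in `{0, 2, -2}`, column dominance bounds the quadratic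
form `∑ c i * c j * M i j` below by `4 β` times the Hamming distance. The form is twice the sum of
`v` over `c = 2` minus twice that over `c = -2`, so one of these two sets works as `B`. -/
theorem exists_finset_le_abs_sum {ι : Type} [Fintype ι] [DecidableEq ι] (M : ι → ι → ℝ) {β : ℝ}
    (hM : ∀ j, β + ∑ i ∈ Finset.univ.erase j, |M i j| ≤ M j j) (b b' : ι → Bool) :
    ∃ B : Finset ι, β * (hammingDist b b' : ℝ) ≤
      |∑ i ∈ B, ∑ j, (bitSign (b j) - bitSign (b' j)) * M i j| := by
  set c : ι → ℝ := fun j => bitSign (b j) - bitSign (b' j) with hc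
  set v : ι → ℝ := fun i => ∑ j, c j * M i j with hv
  have hc3 : ∀ j, (b j = b' j ∧ c j = 0) ∨ (b j ≠ b' j ∧ c j = 2) ∨ (b j ≠ b' j ∧ c j = -2) := by
    intro j
    simp only [hc]
    cases b j <;> cases b' j <;> norm_num [bitSign]
  have hham : (hammingDist b b' : ℝ) = ∑ j, |c j| / 2 := by
    simp only [hammingDist, Finset.card_filter, Nat.cast_sum, Nat.cast_ite, Nat.cast_one,
      Nat.cast_zero]
    refine Finset.sum_congr rfl fun j _ => ?_
    rcases hc3 j with ⟨h1, h2⟩ | ⟨h1, h2⟩ | ⟨h1, h2⟩ <;> simp [h1, h2]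
  have hcabs : ∀ j, |c j| ≤ 2 := by
    intro j
    rcases hc3 j with ⟨h1, h2⟩ | ⟨h1, h2⟩ | ⟨h1, h2⟩ <;> simp [h2]
  have hcol : ∀ j, 2 * |c j| * β ≤ ∑ i, c i * (c j * M i j) := by
    intro j
    rw [← Finset.add_sum_erase _ _ (Finset.mem_univ j)]
    have h1 : -(2 * |c j| * ∑ i ∈ Finset.univ.erase j, |M i j|) ≤
        ∑ i ∈ Finset.univ.erase j, c i * (c j * M i j) := by
      rw [Finset.mul_sum, ← Finset.sum_neg_distrib]
      refine Finset.sum_le_sum fun i _ => ?_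
      refine le_trans (neg_le_neg ?_) (neg_abs_le _)
      rw [abs_mul, abs_mul, ← mul_assoc]
      gcongr
      exact hcabs i
    have h2 : c j * (c j * M j j) = 2 * |c j| * M j j := by
      rcases hc3 j with ⟨_, h⟩ | ⟨_, h⟩ | ⟨_, h⟩ <;> rw [h] <;> norm_num <;> ring
    have h3 := mul_le_mul_of_nonneg_left (hM j) (by positivity : 0 ≤ 2 * |c j|)
    rw [h2]
    linarith
  have htot : 4 * (β * (hammingDist b b' : ℝ)) ≤ ∑ i, c i * v i := by
    calc 4 * (β * (hammingDist b b' : ℝ)) = ∑ j, 2 * |c j| * β := by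
          rw [hham, Finset.mul_sum, Finset.mul_sum]
          exact Finset.sum_congr rfl fun j _ => by ring
      _ ≤ ∑ j, ∑ i, c i * (c j * M i j) := Finset.sum_le_sum fun j _ => hcol j
      _ = ∑ i, c i * v i := by
          rw [Finset.sum_comm]
          exact Finset.sum_congr rfl fun i _ => (Finset.mul_sum _ _ _).symm
  have hsplit : ∑ i, c i * v i = 2 * ∑ i with c i = 2, v i - 2 * ∑ i with c i = -2, v i := by
    rw [Finset.mul_sum, Finset.mul_sum, Finset.sum_filter, Finset.sum_filter,
      ← Finset.sum_sub_distrib]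
    refine Finset.sum_congr rfl fun i _ => ?_
    rcases hc3 i with ⟨_, h⟩ | ⟨_, h⟩ | ⟨_, h⟩ <;> rw [h] <;> norm_num
  by_contra! hcon
  have h1 := hcon {i | c i = 2}
  have h2 := hcon {i | c i = -2}
  have h3 := le_abs_self (∑ i with c i = 2, v i)
  have h4 := neg_abs_le (∑ i with c i = -2, v i)
  change |∑ i with c i = 2, v i| < _ at h1
  change |∑ i with c i = -2, v i| < _ at h2
  linarith

/-- The vertex of the hypercube of densities spanned by the perturbations `φ i`. -/
noncomputable def cubeDensity {ι : Type} [Fintype ι] (φ : ι → ℝ → ℝ) (δ : ℝ) (b : ι → Bool)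
    (x : ℝ) : ℝ :=
  1 / 2 + ∑ i, δ * bitSign (b i) * φ i x

/-- The measure on `[-1,1)` with density `cubeDensity φ δ b`. -/
noncomputable def cubeMeasure {ι : Type} [Fintype ι] (φ : ι → ℝ → ℝ) (δ : ℝ) (b : ι → Bool) :
    Measure ℝ :=
  (volume.restrict (Ico (-1 : ℝ) 1)).withDensity fun x => ENNReal.ofReal (cubeDensity φ δ b x)

namespace SeparatedFamily

variable {ι : Type} [Fintype ι] [DecidableEq ι] {t d : ℕ} {φ : ι → ℝ → ℝ} {S : ι → Set ℝ}
  {β γ δ : ℝ}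

theorem abs_le (h : SeparatedFamily t d φ S β γ) (i : ι) (x : ℝ) : |φ i x| ≤ 2 :=
  (Finset.single_le_sum (f := fun i => |φ i x|) (fun _ _ => abs_nonneg _)
    (Finset.mem_univ i)).trans (h.sum_abs_le x)

theorem integrable (h : SeparatedFamily t d φ S β γ) (i : ι) : Integrable (φ i) := by
  have h1 : IntegrableOn (φ i) (Ico (-1 : ℝ) 1) :=
    Measure.integrableOn_of_bounded (M := 2) (by simp) (h.measurable i).aestronglyMeasurable
      (Filter.Eventually.of_forall fun x => h.abs_le i x)
  have h2 : (Ico (-1 : ℝ) 1).indicator (φ i) = φ i :=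
    indicator_eq_self.2 fun x hx => by_contra fun hx' => hx (h.eq_zero i x hx')
  rw [← h2]
  exact h1.integrable_indicator measurableSet_Ico

theorem measurable_cubeDensity (h : SeparatedFamily t d φ S β γ) (b : ι → Bool) :
    Measurable (cubeDensity φ δ b) :=
  measurable_const.add (Finset.measurable_fun_sum _ fun i _ => (h.measurable i).const_mul _)

theorem quarter_le_cubeDensity (h : SeparatedFamily t d φ S β γ) (hδ : 0 ≤ δ) (hδ' : δ ≤ 1 / 8)
    (b : ι → Bool) (x : ℝ) : 1 / 4 ≤ cubeDensity φ δ b x := by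
  have h1 : |∑ i, δ * bitSign (b i) * φ i x| ≤ 1 / 4 := by
    refine (Finset.abs_sum_le_sum_abs _ _).trans ?_
    simp_rw [abs_mul, abs_bitSign, mul_one, abs_of_nonneg hδ]
    rw [← Finset.mul_sum]
    nlinarith [h.sum_abs_le x]
  have := neg_abs_le (∑ i, δ * bitSign (b i) * φ i x)
  unfold cubeDensity
  linarith

theorem integrableOn_cubeDensity (h : SeparatedFamily t d φ S β γ) (b : ι → Bool) {A : Set ℝ}
    (hA : A ⊆ Ico (-1 : ℝ) 1) : IntegrableOn (cubeDensity φ δ b) A := by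
  refine IntegrableOn.mono_set (t := Ico (-1 : ℝ) 1) ?_ hA
  refine Integrable.add (integrableOn_const (by simp)) ?_
  exact integrable_finsetSum _ fun i _ => ((h.integrable i).const_mul _).integrableOn

theorem setIntegral_Ico (h : SeparatedFamily t d φ S β γ) (i : ι) :
    ∫ x in Ico (-1 : ℝ) 1, φ i x = 0 := by
  rw [setIntegral_eq_integral_of_forall_compl_eq_zero fun x hx => h.eq_zero i x hx,
    h.integral_eq_zero i]

theorem integral_cubeDensity (h : SeparatedFamily t d φ S β γ) (b : ι → Bool) :
    ∫ x in Ico (-1 : ℝ) 1, cubeDensity φ δ b x = 1 := by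
  unfold cubeDensity
  rw [integral_add (integrable_const _)
    (integrable_finsetSum _ fun i _ => ((h.integrable i).const_mul _).integrableOn),
    integral_finsetSum _ fun i _ => ((h.integrable i).const_mul _).integrableOn]
  simp_rw [integral_const_mul, h.setIntegral_Ico]
  simp
  norm_num

theorem isProbabilityMeasure_cubeMeasure (h : SeparatedFamily t d φ S β γ) (hδ : 0 ≤ δ)
    (hδ' : δ ≤ 1 / 8) (b : ι → Bool) : IsProbabilityMeasure (cubeMeasure φ δ b) := by
  constructor
  rw [cubeMeasure, withDensity_apply _ MeasurableSet.univ, Measure.restrict_univ, ← ofReal_integral_eq_lintegral_ofReal (h.integrableOn_cubeDensity b subset_rfl)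
    (Filter.Eventually.of_forall fun x => ?_), h.integral_cubeDensity b, ENNReal.ofReal_one]
  have := h.quarter_le_cubeDensity hδ hδ' b x
  simp only [Pi.zero_apply]
  linarith

theorem isPiecewisePolynomialDistribution_cubeMeasure (h : SeparatedFamily t d φ S β γ)
    (hδ : 0 ≤ δ) (hδ' : δ ≤ 1 / 8) (b : ι → Bool) :
    IsPiecewisePolynomialDistribution t d (cubeMeasure φ δ b) := by
  refine ⟨h.isProbabilityMeasure_cubeMeasure hδ hδ' b, cubeDensity φ δ b, h.piecewise _ _,
    fun x _ => ?_, rfl⟩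
  linarith [h.quarter_le_cubeDensity hδ hδ' b x]

theorem cubeMeasure_real_apply (h : SeparatedFamily t d φ S β γ) (hδ : 0 ≤ δ) (hδ' : δ ≤ 1 / 8)
    (b : ι → Bool) {A : Set ℝ} (hAm : MeasurableSet A) (hA : A ⊆ Ico (-1 : ℝ) 1) :
    (cubeMeasure φ δ b).real A = ∫ x in A, cubeDensity φ δ b x := by
  rw [measureReal_def, cubeMeasure, withDensity_apply _ hAm, Measure.restrict_restrict hAm,
    inter_eq_left.2 hA, ← ofReal_integral_eq_lintegral_ofReal (h.integrableOn_cubeDensity b hA)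
    (Filter.Eventually.of_forall fun x => ?_), ENNReal.toReal_ofReal]
  · refine setIntegral_nonneg hAm fun x _ => ?_
    linarith [h.quarter_le_cubeDensity hδ hδ' b x]
  · have := h.quarter_le_cubeDensity hδ hδ' b x
    simp only [Pi.zero_apply]
    linarith

theorem cubeMeasure_sub (h : SeparatedFamily t d φ S β γ) (hδ : 0 ≤ δ) (hδ' : δ ≤ 1 / 8)
    (b b' : ι → Bool) (B : Finset ι) :
    (cubeMeasure φ δ b).real (⋃ i ∈ B, S i) - (cubeMeasure φ δ b').real (⋃ i ∈ B, S i) =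
      δ * ∑ i ∈ B, ∑ j, (bitSign (b j) - bitSign (b' j)) * ∫ x in S i, φ j x := by
  have hm : MeasurableSet (⋃ i ∈ B, S i) := B.measurableSet_biUnion fun i _ => h.measurableSet i
  have hs : (⋃ i ∈ B, S i) ⊆ Ico (-1 : ℝ) 1 := iUnion₂_subset fun i _ => h.subset i
  rw [h.cubeMeasure_real_apply hδ hδ' b hm hs, h.cubeMeasure_real_apply hδ hδ' b' hm hs,
    ← integral_sub (h.integrableOn_cubeDensity b hs) (h.integrableOn_cubeDensity b' hs)]
  have h1 : ∀ x, cubeDensity φ δ b x - cubeDensity φ δ b' x =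
      ∑ j, δ * (bitSign (b j) - bitSign (b' j)) * φ j x := by
    intro x
    simp only [cubeDensity, add_sub_add_left_eq_sub, ← Finset.sum_sub_distrib]
    exact Finset.sum_congr rfl fun j _ => by ring
  simp_rw [h1]
  rw [integral_biUnion_finset B (fun i _ => h.measurableSet i) (fun i _ j _ hij => h.disjoint hij)
    fun i _ => integrable_finsetSum _ fun j _ => ((h.integrable j).const_mul _).integrableOn,
    Finset.mul_sum]
  refine Finset.sum_congr rfl fun i _ => ?_
  rw [integral_finsetSum _ fun j _ => ((h.integrable j).const_mul _).integrableOn, Finset.mul_sum]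
  refine Finset.sum_congr rfl fun j _ => ?_
  rw [integral_const_mul, mul_assoc]

theorem exists_hammingDist_le (h : SeparatedFamily t d φ S β γ) (hδ : 0 ≤ δ) (hδ' : δ ≤ 1 / 8)
    (b b' : ι → Bool) :
    ∃ B : Finset ι, δ * β * (hammingDist b b' : ℝ) ≤
      |(cubeMeasure φ δ b).real (⋃ i ∈ B, S i) - (cubeMeasure φ δ b').real (⋃ i ∈ B, S i)| := by
  obtain ⟨B, hB⟩ := exists_finset_le_abs_sum (fun i j => ∫ x in S i, φ j x) (β := β)
    (fun j => le_trans (by gcongr with i _; exact abs_integral_le_integral_abs) (h.dominant j)) b b'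
  refine ⟨B, ?_⟩
  rw [h.cubeMeasure_sub hδ hδ', abs_mul, abs_of_nonneg hδ, mul_assoc]
  exact mul_le_mul_of_nonneg_left hB hδ

theorem cubeDensity_sub_update (b : ι → Bool) (j : ι) (x : ℝ) :
    |cubeDensity φ δ b x - cubeDensity φ δ (Function.update b j (!b j)) x| = 2 * |δ| * |φ j x| := by
  have h1 : cubeDensity φ δ b x - cubeDensity φ δ (Function.update b j (!b j)) x =
      2 * δ * bitSign (b j) * φ j x := by
    simp only [cubeDensity, add_sub_add_left_eq_sub, ← Finset.sum_sub_distrib]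
    rw [Finset.sum_eq_single j]
    · simp only [Function.update_self]
      cases b j <;> simp [bitSign] <;> ring
    · intro i _ hij
      simp [hij]
    · simp
  rw [h1]
  simp [abs_mul, abs_bitSign]

/-- The pointwise chi-square identity `a² / a' = 2a - a' + (a - a')² / a'`: for probability
densities the first two terms integrate to 1. -/
theorem sq_div_mul_le {a a' D : ℝ} (ha' : 1 / 4 ≤ a') (hD : (a - a') ^ 2 ≤ D) :
    (a / a') ^ 2 * a' ≤ 2 * a - a' + 4 * D := by
  have h0 : 0 < a' := by linarith
  have h1 : (a / a') ^ 2 * a' = 2 * a - a' + (a - a') ^ 2 / a' := by field_simp; ring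
  have h2 : (a - a') ^ 2 / a' ≤ 4 * D := by
    rw [div_le_iff₀ h0]
    nlinarith [sq_nonneg (a - a')]
  linarith

theorem one_eighth_le (h : SeparatedFamily t d φ S β γ) (hδ : 0 ≤ δ) (hδ' : δ ≤ 1 / 8)
    {Ω : Type*} [MeasurableSpace Ω] (μ : Measure Ω) [IsProbabilityMeasure μ] {n : ℕ}
    (hn : n * (32 * δ ^ 2 * γ) ≤ 1 / 2)
    (b : ι → Bool) (j : ι) {E : Set (Ω × (Fin n → ℝ))} (hE : MeasurableSet E) :
    1 / 8 ≤ (μ.prod (Measure.pi fun _ : Fin n => cubeMeasure φ δ b)).real E +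
      (μ.prod (Measure.pi fun _ : Fin n =>
        cubeMeasure φ δ (Function.update b j (!b j)))).real Eᶜ := by
  set b' := Function.update b j (!b j) with hb'
  have hp := h.isProbabilityMeasure_cubeMeasure hδ hδ' b
  have hp' := h.isProbabilityMeasure_cubeMeasure hδ hδ' b'
  have hq := h.quarter_le_cubeDensity hδ hδ' b
  have hq' := h.quarter_le_cubeDensity hδ hδ' b'
  set f := cubeDensity φ δ b with hf
  set f' := cubeDensity φ δ b' with hf'
  have hfm : Measurable f := h.measurable_cubeDensity b
  have hfm' : Measurable f' := h.measurable_cubeDensity b'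
  have hLm : Measurable fun x => ENNReal.ofReal (f x / f' x) := (hfm.div hfm').ennreal_ofReal
  have hwd : cubeMeasure φ δ b =
      (cubeMeasure φ δ b').withDensity fun x => ENNReal.ofReal (f x / f' x) := by
    unfold cubeMeasure
    rw [← withDensity_mul _ hfm'.ennreal_ofReal hLm]
    congr 1
    ext x
    have h0 : 0 < f' x := by linarith [hq' x]
    rw [Pi.mul_apply, ← ENNReal.ofReal_mul h0.le, mul_div_cancel₀ _ h0.ne']
  have hint : IntegrableOn (fun x => 2 * f x - f' x + 4 * (8 * δ ^ 2 * |φ j x|))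
      (Ico (-1 : ℝ) 1) :=
    (((h.integrableOn_cubeDensity b subset_rfl).const_mul 2).sub
      (h.integrableOn_cubeDensity b' subset_rfl)).add
      ((((h.integrable j).abs.const_mul _).const_mul _).integrableOn)
  -- The densities differ by `2 δ |φ j|`, and `|φ j| ≤ 2` turns the square `4 δ² |φ j|²` into `8 δ²
  -- |φ j|`, so that only the L¹ bound `γ` is needed.
  have hpt : ∀ x, (f x / f' x) ^ 2 * f' x ≤ 2 * f x - f' x + 4 * (8 * δ ^ 2 * |φ j x|) := by
    intro x
    refine sq_div_mul_le (hq' x) ?_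
    rw [← sq_abs, cubeDensity_sub_update, abs_of_nonneg hδ]
    nlinarith [h.abs_le j x, abs_nonneg (φ j x), sq_nonneg δ,
      mul_nonneg (sq_nonneg δ) (abs_nonneg (φ j x)),
      mul_nonneg (mul_nonneg (sq_nonneg δ) (abs_nonneg (φ j x))) (sub_nonneg.2 (h.abs_le j x))]
  have hI : ∫ x in Ico (-1 : ℝ) 1, (2 * f x - f' x + 4 * (8 * δ ^ 2 * |φ j x|)) ≤
      1 + 32 * δ ^ 2 * γ := by
    have hf2 : IntegrableOn (fun x => 2 * f x) (Ico (-1 : ℝ) 1) :=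
      (h.integrableOn_cubeDensity b subset_rfl).const_mul 2
    have hff : IntegrableOn (fun x => 2 * f x - f' x) (Ico (-1 : ℝ) 1) :=
      hf2.sub (h.integrableOn_cubeDensity b' subset_rfl)
    rw [integral_add hff ((((h.integrable j).abs.const_mul _).const_mul _).integrableOn),
      integral_sub hf2 (h.integrableOn_cubeDensity b' subset_rfl), integral_const_mul,
      integral_const_mul, integral_const_mul, h.integral_cubeDensity, h.integral_cubeDensity,
      setIntegral_eq_integral_of_forall_compl_eq_zero fun x hx => by rw [h.eq_zero j x hx, abs_zero]]
    nlinarith [h.integral_abs_le j, sq_nonneg δ]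
  have hL2 : ∫⁻ x, ENNReal.ofReal (f x / f' x) ^ 2 ∂(cubeMeasure φ δ b') ≤
      ENNReal.ofReal (1 + 32 * δ ^ 2 * γ) := by
    unfold cubeMeasure
    rw [lintegral_withDensity_eq_lintegral_mul _ hfm'.ennreal_ofReal (hLm.pow_const 2)]
    refine le_trans (lintegral_mono fun x => ?_) (le_trans
      (ofReal_integral_eq_lintegral_ofReal hint (Filter.Eventually.of_forall fun x => ?_)).ge
      (ENNReal.ofReal_le_ofReal hI))
    · have h0 : 0 ≤ f x / f' x := div_nonneg (by linarith [hq x]) (by linarith [hq' x])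
      rw [Pi.mul_apply, ← ENNReal.ofReal_pow h0, mul_comm, ← ENNReal.ofReal_mul (by positivity)]
      exact ENNReal.ofReal_le_ofReal (hpt x)
    · refine le_trans ?_ (hpt x)
      have : 0 ≤ f' x := by linarith [hq' x]
      simp only [Pi.zero_apply]
      positivity
  have hγ : 0 ≤ γ := (integral_nonneg fun x => abs_nonneg _).trans (h.integral_abs_le j)
  have h2 : (∫⁻ x, ENNReal.ofReal (f x / f' x) ^ 2 ∂(cubeMeasure φ δ b')) ^ n ≤ 2 := by
    refine (pow_le_pow_left' hL2 n).trans ?_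
    rw [← ENNReal.ofReal_pow (by positivity)]
    refine ENNReal.ofReal_le_of_le_toReal ?_
    -- The second moment tensorizes to at most `exp (1/2)`, which is below 2.
    have h1 : (1 + 32 * δ ^ 2 * γ) ^ n ≤ Real.exp (n * (32 * δ ^ 2 * γ)) := by
      rw [Real.exp_nat_mul]
      refine pow_le_pow_left₀ (by positivity) ?_ n
      linarith [Real.add_one_le_exp (32 * δ ^ 2 * γ)]
    have h2 : Real.exp (n * (32 * δ ^ 2 * γ)) ≤ Real.exp (1 / 2) := Real.exp_le_exp.2 hn
    have h3 : Real.exp (1 / 2) ≤ 2 := by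
      have h4 : Real.exp (1 / 2) * Real.exp (1 / 2) = Real.exp 1 := by
        rw [← Real.exp_add]; norm_num
      have h5 := Real.exp_one_lt_d9
      nlinarith [Real.exp_pos (1 / 2)]
    simpa using h1.trans (h2.trans h3)
  have hpr : IsProbabilityMeasure
      ((cubeMeasure φ δ b').withDensity fun x => ENNReal.ofReal (f x / f' x)) := hwd ▸ hp
  rw [hwd]
  exact one_eighth_le_errors μ (cubeMeasure φ δ b') hLm h2 hE

/-- A separated family forces many samples. -/
theorem half_lt_of_learns (h : SeparatedFamily t d φ S β γ) (hδ : 0 ≤ δ) (hδ' : δ ≤ 1 / 8)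
    (hβ : 0 ≤ β) {ε : ℝ} (hε : 0 ≤ ε) (hεδ : 32 * ε < δ * β * Fintype.card ι) {n : ℕ}
    (L : LearningAlgorithm.{u} n) (hL : L.Learns t d ε) : 1 / 2 < n * (32 * δ ^ 2 * γ) := by
  by_contra! hn
  refine hεδ.not_ge (assouad L (cubeMeasure φ δ)
    (fun b => h.isProbabilityMeasure_cubeMeasure hδ hδ' b) (fun B : Finset ι => ⋃ i ∈ B, S i)
    (fun B => B.measurableSet_biUnion fun i _ => h.measurableSet i) (mul_nonneg hδ hβ) hε
    (fun b b' => h.exists_hammingDist_le hδ hδ' b b')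
    (fun b j E hE => h.one_eighth_le hδ hδ' _ hn b j hE)
    fun b => hL _ (h.isPiecewisePolynomialDistribution_cubeMeasure hδ hδ' b))

end SeparatedFamily

/-! ### Piecewise polynomials and replication on equal subintervals. -/

/-- Missing pieces are padded with empty intervals carrying the zero polynomial, so pieces may be
indexed by pairs or bits. -/
theorem isPiecewisePolynomial_of_fintype {κ : Type*} [Fintype κ] {t d : ℕ} {f : ℝ → ℝ}
    (hκ : Fintype.card κ ≤ t) (I : κ → Set ℝ) (q : κ → Polynomial ℝ)
    (hI : ∀ j, (I j).OrdConnected) (hd : ∀ i j, i ≠ j → Disjoint (I i) (I j))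
    (hU : ⋃ j, I j = Ico (-1 : ℝ) 1) (hq : ∀ j, (q j).natDegree ≤ d)
    (hf : ∀ j, ∀ x ∈ I j, f x = (q j).eval x) : IsPiecewisePolynomial t d f := by
  obtain ⟨e⟩ : Nonempty (κ ↪ Fin t) :=
    Function.Embedding.nonempty_of_card_le (by simpa using hκ)
  have hcase : ∀ j, (∃ k, e k = j) ∨ Function.extend e I (fun _ => ∅) j = ∅ ∧
      Function.extend e q 0 j = 0 := by
    intro j
    by_cases h : ∃ k, e k = j
    · exact Or.inl h
    · exact Or.inr ⟨Function.extend_apply' _ _ _ h, Function.extend_apply' _ _ _ h⟩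
  refine ⟨Function.extend e I fun _ => ∅, Function.extend e q 0, fun j => ?_, fun i j hij => ?_, ?_,
    fun j => ?_, fun j x hx => ?_⟩
  · rcases hcase j with ⟨k, rfl⟩ | ⟨h, -⟩
    · rw [e.injective.extend_apply]; exact hI k
    · rw [h]; exact ordConnected_empty
  · rcases hcase i with ⟨k, rfl⟩ | ⟨h, -⟩
    · rcases hcase j with ⟨l, rfl⟩ | ⟨h, -⟩
      · rw [e.injective.extend_apply, e.injective.extend_apply]
        exact hd _ _ fun h => hij (h ▸ rfl)
      · rw [h]; exact disjoint_empty _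
    · rw [h]; exact empty_disjoint _
  · rw [← hU]
    ext x
    simp only [mem_iUnion]
    constructor
    · rintro ⟨j, hj⟩
      rcases hcase j with ⟨k, rfl⟩ | ⟨h, -⟩
      · rw [e.injective.extend_apply] at hj; exact ⟨k, hj⟩
      · rw [h] at hj; exact hj.elim
    · rintro ⟨k, hk⟩
      exact ⟨e k, by rwa [e.injective.extend_apply]⟩
  · rcases hcase j with ⟨k, rfl⟩ | ⟨-, h⟩
    · rw [e.injective.extend_apply]; exact hq k
    · rw [h]; simp
  · rcases hcase j with ⟨k, rfl⟩ | ⟨h, -⟩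
    · rw [e.injective.extend_apply] at hx ⊢; exact hf k x hx
    · rw [h] at hx; exact hx.elim

theorem IsPiecewisePolynomial.mono {t t' d : ℕ} {f : ℝ → ℝ} (hf : IsPiecewisePolynomial t d f)
    (ht : t ≤ t') : IsPiecewisePolynomial t' d f := by
  obtain ⟨I, q, h1, h2, h3, h4, h5⟩ := hf
  exact isPiecewisePolynomial_of_fintype (by simpa using ht) I q h1 h2 h3 h4 h5

/-- The affine map sending the `a`-th of `s` equal subintervals of `[-1,1)` onto `[-1,1)`. -/
noncomputable def cellCoord (s : ℕ) (a : Fin s) (x : ℝ) : ℝ := s * x + (s - 1 - 2 * a)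

theorem cellCoord_unique {s : ℕ} {a b : Fin s} {x : ℝ} (ha : cellCoord s a x ∈ Ico (-1 : ℝ) 1)
    (hb : cellCoord s b x ∈ Ico (-1 : ℝ) 1) : a = b := by
  unfold cellCoord at ha hb
  have h1 : ((a : ℕ) : ℝ) < (b : ℕ) + 1 := by linarith [ha.1, hb.2]
  have h2 : ((b : ℕ) : ℝ) < (a : ℕ) + 1 := by linarith [hb.1, ha.2]
  have h3 : (a : ℕ) < b + 1 := by exact_mod_cast h1
  have h4 : (b : ℕ) < a + 1 := by exact_mod_cast h2
  exact Fin.ext (by omega)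

theorem exists_cellCoord_mem {s : ℕ} {x : ℝ} (hs : 0 < s) (hx : x ∈ Ico (-1 : ℝ) 1) :
    ∃ a : Fin s, cellCoord s a x ∈ Ico (-1 : ℝ) 1 := by
  have hs' : (0 : ℝ) < s := by exact_mod_cast hs
  have h0 : 0 ≤ s * (x + 1) / 2 := by have := hx.1; have : 0 ≤ x + 1 := by linarith
                                      positivity
  have h1 : s * (x + 1) / 2 < s := by nlinarith [hx.2]
  have h2 := Nat.floor_le h0
  have h3 := Nat.lt_floor_add_one (s * (x + 1) / 2)
  refine ⟨⟨⌊s * (x + 1) / 2⌋₊, (Nat.floor_lt h0).2 h1⟩, ?_, ?_⟩ <;> unfold cellCoord <;>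
    simp only <;> linarith

theorem mem_Ico_of_cellCoord {s : ℕ} {a : Fin s} {x : ℝ}
    (ha : cellCoord s a x ∈ Ico (-1 : ℝ) 1) : x ∈ Ico (-1 : ℝ) 1 := by
  have h1 : ((a : ℕ) : ℝ) + 1 ≤ s := by exact_mod_cast a.2
  have h0 : (0 : ℝ) ≤ (a : ℕ) := by positivity
  have hs : (0 : ℝ) < s := by linarith
  unfold cellCoord at ha
  obtain ⟨h2, h3⟩ := ha
  constructor <;> by_contra! hcon <;> nlinarith

theorem measurable_cellCoord {s : ℕ} (a : Fin s) : Measurable (cellCoord s a) := by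
  unfold cellCoord; fun_prop

theorem integral_comp_cellCoord {s : ℕ} (a : Fin s) (g : ℝ → ℝ) :
    ∫ x, g (cellCoord s a x) = (s : ℝ)⁻¹ * ∫ x, g x := by
  have h1 := Measure.integral_comp_mul_left (fun y => g (y + (s - 1 - 2 * a))) (s : ℝ)
  unfold cellCoord
  rw [h1, integral_add_right_eq_self g, smul_eq_mul, abs_of_nonneg (by positivity)]

theorem setIntegral_comp_cellCoord {s : ℕ} (a : Fin s) (g : ℝ → ℝ) {S : Set ℝ}
    (hS : MeasurableSet S) :
    ∫ x in cellCoord s a ⁻¹' S, g (cellCoord s a x) = (s : ℝ)⁻¹ * ∫ x in S, g x := by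
  rw [← integral_indicator (measurable_cellCoord a hS), ← integral_indicator hS,
    ← integral_comp_cellCoord a]
  rfl

namespace SeparatedFamily

variable {ι : Type} [Fintype ι] [DecidableEq ι] {t d : ℕ} {φ : ι → ℝ → ℝ} {S : ι → Set ℝ}
  {β γ : ℝ}

theorem mono {t' : ℕ} (h : SeparatedFamily t d φ S β γ) (ht : t ≤ t') :
    SeparatedFamily t' d φ S β γ :=
  { h with piecewise := fun c a => (h.piecewise c a).mono ht }

/-- Scaled copies of a separated family on `s` equal subintervals form a separated family. -/
theorem replicate (h : SeparatedFamily t d φ S β γ) {s : ℕ} (hs : 0 < s) :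
    SeparatedFamily (ι := Fin s × ι) (s * t) d (fun p x => φ p.2 (cellCoord s p.1 x))
      (fun p => cellCoord s p.1 ⁻¹' S p.2) (β / s) (γ / s) where
  measurable p := (h.measurable p.2).comp (measurable_cellCoord p.1)
  measurableSet p := measurable_cellCoord p.1 (h.measurableSet p.2)
  eq_zero p x hx := h.eq_zero _ _ fun h' => hx (mem_Ico_of_cellCoord h')
  sum_abs_le x := by
    rw [Fintype.sum_prod_type]
    by_cases hx : ∃ a : Fin s, cellCoord s a x ∈ Ico (-1 : ℝ) 1
    · obtain ⟨a, ha⟩ := hx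
      rw [Finset.sum_eq_single a]
      · exact h.sum_abs_le (cellCoord s a x)
      · intro b _ hb
        refine Finset.sum_eq_zero fun i _ => ?_
        rw [h.eq_zero i _ fun hb' => hb (cellCoord_unique hb' ha), abs_zero]
      · simp
    · push Not at hx
      rw [Finset.sum_eq_zero]
      · norm_num
      · intro b _
        refine Finset.sum_eq_zero fun i _ => ?_
        rw [h.eq_zero i _ (hx b), abs_zero]
  integral_eq_zero p := by
    rw [integral_comp_cellCoord p.1 (φ p.2), h.integral_eq_zero, mul_zero]
  subset p x hx := mem_Ico_of_cellCoord (h.subset p.2 hx)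
  disjoint p q hpq := by
    refine Set.disjoint_left.2 fun x hx hx' => ?_
    have h1 := cellCoord_unique (h.subset _ hx) (h.subset _ hx')
    have h2 : p.2 ≠ q.2 := fun h2 => hpq (Prod.ext h1 h2)
    refine Set.disjoint_left.1 (h.disjoint h2) hx ?_
    rw [h1]; exact hx'
  dominant := by
    rintro ⟨a, j⟩
    -- Writing the punctured sum as full sum minus one term lets it collapse to cell `a`: the copy
    -- of `φ j` there vanishes on test sets of other cells.
    rw [Finset.sum_erase_eq_sub (Finset.mem_univ _), Fintype.sum_prod_type,
      Finset.sum_eq_single a]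
    · simp only [setIntegral_comp_cellCoord a (fun y => |φ j y|) (h.measurableSet _),
        setIntegral_comp_cellCoord a (φ j) (h.measurableSet j)]
      rw [← Finset.mul_sum, ← mul_sub]
      have h1 := h.dominant j
      rw [Finset.sum_erase_eq_sub (Finset.mem_univ _)] at h1
      rw [div_eq_inv_mul, ← mul_add]
      gcongr
    · intro b _ hb
      refine Finset.sum_eq_zero fun i _ => ?_
      refine setIntegral_eq_zero_of_forall_eq_zero fun x hx => ?_
      have : cellCoord s a x ∉ Ico (-1 : ℝ) 1 := fun ha => hb (cellCoord_unique (h.subset _ hx) ha)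
      rw [h.eq_zero j _ this, abs_zero]
    · simp
  integral_abs_le p := by
    rw [integral_comp_cellCoord p.1 fun y => |φ p.2 y|, div_eq_inv_mul]
    gcongr
    exact h.integral_abs_le p.2
  piecewise c w := by
    choose I q h1 h2 h3 h4 h5 using fun a : Fin s => h.piecewise c fun i => w (a, i)
    have hsub : ∀ a k, I a k ⊆ Ico (-1 : ℝ) 1 := fun a k => (h3 a) ▸ subset_iUnion (I a) k
    refine isPiecewisePolynomial_of_fintype (κ := Fin s × Fin t) (by simp)
      (fun p => cellCoord s p.1 ⁻¹' I p.1 p.2)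
      (fun p => (q p.1 p.2).comp (Polynomial.C (s : ℝ) * Polynomial.X +
        Polynomial.C ((s : ℝ) - 1 - 2 * (p.1 : ℕ)))) (fun p => ?_) (fun p p' hp => ?_) ?_
      (fun p => ?_) (fun p x hx => ?_)
    · refine (h1 p.1 p.2).preimage_mono fun x y hxy => ?_
      unfold cellCoord
      gcongr
    · rw [Set.disjoint_left]
      intro x hx hx'
      have e1 := cellCoord_unique (hsub _ _ hx) (hsub _ _ hx')
      obtain ⟨a, k⟩ := p
      obtain ⟨a', k'⟩ := p'
      obtain rfl : a = a' := e1
      have e2 : k ≠ k' := fun e2 => hp (e2 ▸ rfl)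
      exact Set.disjoint_left.1 (h2 a k k' e2) hx hx'
    · ext x
      simp only [mem_iUnion]
      constructor
      · rintro ⟨p, hp⟩
        exact mem_Ico_of_cellCoord (hsub _ _ hp)
      · intro hx
        obtain ⟨a, ha⟩ := exists_cellCoord_mem hs hx
        rw [← h3 a] at ha
        obtain ⟨k, hk⟩ := mem_iUnion.1 ha
        exact ⟨(a, k), hk⟩
    · refine Polynomial.natDegree_comp_le.trans ?_
      calc _ ≤ d * 1 := Nat.mul_le_mul (h4 _ _) Polynomial.natDegree_linear_le
        _ = d := mul_one d
    · have e1 := h5 p.1 p.2 _ hx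
      have e2 : (Polynomial.C (s : ℝ) * Polynomial.X +
        Polynomial.C ((s : ℝ) - 1 - 2 * (p.1 : ℕ))).eval x = cellCoord s p.1 x := by
        simp [cellCoord]
      rw [Polynomial.eval_comp, e2, ← e1, Fintype.sum_prod_type, Finset.sum_eq_single p.1]
      · intro b _ hb
        refine Finset.sum_eq_zero fun i _ => ?_
        rw [h.eq_zero i _ fun hb' => hb (cellCoord_unique hb' (hsub _ _ hx)), mul_zero]
      · simp

end SeparatedFamily

/-! ### Basic families: steps and odd polynomials. -/

/-- The two-valued step perturbation. -/
theorem separatedFamily_step :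
    SeparatedFamily (ι := Unit) 2 0
      (fun _ x => (Ico (0 : ℝ) 1).indicator (fun _ => 1) x -
        (Ico (-1 : ℝ) 0).indicator (fun _ => 1) x)
      (fun _ => Ico (0 : ℝ) 1) 1 2 where
  measurable _ := (measurable_const.indicator measurableSet_Ico).sub
    (measurable_const.indicator measurableSet_Ico)
  measurableSet _ := measurableSet_Ico
  eq_zero _ x hx := by
    rw [indicator_of_notMem fun h => hx ⟨by linarith [h.1], h.2⟩,
      indicator_of_notMem fun h => hx ⟨h.1, by linarith [h.2]⟩, sub_zero]
  sum_abs_le x := by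
    simp only [Finset.univ_unique, Finset.sum_const, Finset.card_singleton, one_smul,
      Set.indicator_apply]
    split_ifs <;> norm_num
  integral_eq_zero _ := by
    rw [integral_sub ((integrable_indicator_iff measurableSet_Ico).2 (integrableOn_const (by simp)))
      ((integrable_indicator_iff measurableSet_Ico).2 (integrableOn_const (by simp))),
      integral_indicator_const _ measurableSet_Ico, integral_indicator_const _ measurableSet_Ico]
    simp
  subset _ := Ico_subset_Ico_left (by norm_num)
  disjoint i j hij := (hij rfl).elim
  dominant j := by
    have he : (Finset.univ : Finset Unit).erase j = ∅ := rfl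
    rw [he, Finset.sum_empty, add_zero,
      setIntegral_congr_fun (g := fun _ => (1 : ℝ)) measurableSet_Ico]
    · simp
    · intro x hx
      simp only
      rw [indicator_of_mem hx, indicator_of_notMem fun h => by linarith [h.2, hx.1], sub_zero]
  integral_abs_le _ := by
    have h1 : ∀ x : ℝ, |(Ico (0 : ℝ) 1).indicator (fun _ => (1 : ℝ)) x -
        (Ico (-1 : ℝ) 0).indicator (fun _ => 1) x| =
        (Ico (0 : ℝ) 1).indicator (fun _ => 1) x + (Ico (-1 : ℝ) 0).indicator (fun _ => 1) x := by
      intro x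
      simp only [Set.indicator_apply]
      split_ifs with h h'
      · linarith [h.1, h'.2]
      all_goals simp
    simp_rw [h1]
    rw [integral_add ((integrable_indicator_iff measurableSet_Ico).2 (integrableOn_const (by simp)))
      ((integrable_indicator_iff measurableSet_Ico).2 (integrableOn_const (by simp))),
      integral_indicator_const _ measurableSet_Ico, integral_indicator_const _ measurableSet_Ico]
    norm_num
  piecewise c a := by
    refine isPiecewisePolynomial_of_fintype (κ := Bool) (by simp)
      (fun b => bif b then Ico 0 1 else Ico (-1) 0)
      (fun b => Polynomial.C (bif b then c + a () else c - a ())) ?_ ?_ ?_ ?_ ?_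
    · rintro (_ | _) <;> exact ordConnected_Ico
    · have : Disjoint (Ico (-1 : ℝ) 0) (Ico (0 : ℝ) 1) := Ico_disjoint_Ico_same
      rintro (_ | _) (_ | _) h
      · exact (h rfl).elim
      · exact this
      · exact this.symm
      · exact (h rfl).elim
    · rw [← union_eq_iUnion, union_comm]
      exact Ico_union_Ico_eq_Ico (by norm_num) (by norm_num)
    · intro j; simp
    · rintro (_ | _) x hx
      · simp only [cond_false] at hx
        simp only [Finset.univ_unique, Finset.sum_singleton, Polynomial.eval_C, cond_false]
        rw [indicator_of_mem hx, indicator_of_notMem fun h => by linarith [h.1, hx.2]]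
        simp [sub_eq_add_neg]
      · simp only [cond_true] at hx
        simp only [Finset.univ_unique, Finset.sum_singleton, Polynomial.eval_C, cond_true]
        rw [indicator_of_mem hx, indicator_of_notMem fun h => by linarith [h.2, hx.1]]
        simp

/-- Odd polynomials with test sets in `[0,1)` restrict to a separated family on `[-1,1)`. -/
theorem separatedFamily_of_odd {ι : Type} [Fintype ι] [DecidableEq ι] {d : ℕ}
    (p : ι → Polynomial ℝ) (S : ι → Set ℝ) {β γ : ℝ} (hdeg : ∀ i, (p i).natDegree ≤ d)
    (hodd : ∀ i x, (p i).eval (-x) = -(p i).eval x)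
    (hsum : ∀ x ∈ Icc (0 : ℝ) 1, ∑ i, |(p i).eval x| ≤ 2)
    (hS : ∀ i, MeasurableSet (S i)) (hS' : ∀ i, S i ⊆ Ico (0 : ℝ) 1)
    (hdisj : Pairwise fun i j => Disjoint (S i) (S j))
    (hdom : ∀ j, β + ∑ i ∈ Finset.univ.erase j, ∫ x in S i, |(p j).eval x| ≤
      ∫ x in S j, (p j).eval x)
    (hγ : ∀ i, 2 * ∫ x in Ico (0 : ℝ) 1, |(p i).eval x| ≤ γ) :
    SeparatedFamily 1 d (fun i => (Ico (-1 : ℝ) 1).indicator fun x => (p i).eval x) S β γ := by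
  have hsub : Ico (0 : ℝ) 1 ⊆ Ico (-1 : ℝ) 1 := Ico_subset_Ico_left (by norm_num)
  have hcongr : ∀ (i j) (F : ℝ → ℝ), ∫ x in S i, F ((Ico (-1 : ℝ) 1).indicator
      (fun x => (p j).eval x) x) = ∫ x in S i, F ((p j).eval x) := fun i j F =>
    setIntegral_congr_fun (hS i) fun x hx => by
      rw [indicator_of_mem (hsub (hS' i hx))]
  refine ⟨fun i => (p i).continuous.measurable.indicator measurableSet_Ico, hS,
    fun i x hx => indicator_of_notMem hx _, fun x => ?_, fun i => ?_, fun i => (hS' i).trans hsub,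
    hdisj, fun j => ?_, fun i => ?_, fun c a => ?_⟩
  · by_cases hx : x ∈ Ico (-1 : ℝ) 1
    · simp_rw [indicator_of_mem hx]
      rcases le_total 0 x with h0 | h0
      · exact hsum x ⟨h0, hx.2.le⟩
      · refine le_trans (le_of_eq ?_) (hsum (-x) ⟨by linarith, by linarith [hx.1]⟩)
        simp_rw [hodd, abs_neg]
    · simp_rw [indicator_of_notMem hx]
      simp
  · rw [integral_indicator measurableSet_Ico, integral_Ico_eq_integral_Ioc,
      ← intervalIntegral.integral_of_le (by norm_num)]
    -- Oddness forces mean zero without any correction term.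
    have h1 := intervalIntegral.integral_comp_neg (a := (-1 : ℝ)) (b := 1)
      (fun x => (p i).eval x)
    simp_rw [hodd, intervalIntegral.integral_neg, neg_neg] at h1
    linarith
  · have h1 := hcongr j j id
    simp only [id] at h1
    rw [h1]
    simp_rw [hcongr _ _ fun y => |y|]
    exact hdom j
  · refine le_trans (le_of_eq ?_) (hγ i)
    have h0 : (fun x => |(Ico (-1 : ℝ) 1).indicator (fun x => (p i).eval x) x|) =
        (Ico (-1 : ℝ) 1).indicator fun x => |(p i).eval x| := by
      ext x
      by_cases hx : x ∈ Ico (-1 : ℝ) 1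
      · rw [indicator_of_mem hx, indicator_of_mem hx]
      · rw [indicator_of_notMem hx, indicator_of_notMem hx, abs_zero]
    have hc : Continuous fun x => |(p i).eval x| := (p i).continuous.abs
    rw [h0, integral_indicator measurableSet_Ico, integral_Ico_eq_integral_Ioc,
      integral_Ico_eq_integral_Ioc,
      ← intervalIntegral.integral_of_le (by norm_num),
      ← intervalIntegral.integral_of_le (by norm_num),
      ← intervalIntegral.integral_add_adjacent_intervals (b := 0) (hc.intervalIntegrable _ _)
        (hc.intervalIntegrable _ _)]
    have h1 := intervalIntegral.integral_comp_neg (a := (0 : ℝ)) (b := 1)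
      (fun x => |(p i).eval x|)
    simp_rw [hodd, abs_neg, neg_zero] at h1
    linarith
  · refine isPiecewisePolynomial_of_fintype (κ := Unit) (by simp) (fun _ => Ico (-1 : ℝ) 1)
      (fun _ => Polynomial.C c + ∑ i, Polynomial.C (a i) * p i) (fun _ => ordConnected_Ico)
      (fun i j hij => (hij rfl).elim) (iUnion_const _) (fun _ => ?_) (fun _ x hx => ?_)
    · refine Polynomial.natDegree_add_le_of_degree_le (by simp) ?_
      exact Polynomial.natDegree_sum_le_of_forall_le _ _ fun i _ =>
        (Polynomial.natDegree_C_mul_le _ _).trans (hdeg i)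
    · simp_rw [indicator_of_mem hx]
      simp [Polynomial.eval_finsetSum]

/-- Serves the degrees `1 ≤ d < 280`, where one perturbation per interval loses only a constant
factor. -/
theorem separatedFamily_X {d : ℕ} (hd : 1 ≤ d) :
    SeparatedFamily (ι := Unit) 1 d
      (fun _ => (Ico (-1 : ℝ) 1).indicator fun x => (Polynomial.X : Polynomial ℝ).eval x)
      (fun _ => Ico (0 : ℝ) 1) (1 / 2) 2 := by
  have hI : ∫ x in Ico (0 : ℝ) 1, x = 1 / 2 := by
    rw [integral_Ico_eq_integral_Ioc, ← intervalIntegral.integral_of_le (by norm_num), integral_id]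
    norm_num
  refine separatedFamily_of_odd (fun _ => Polynomial.X) (fun _ => Ico (0 : ℝ) 1) (fun _ => by simpa)
    (fun _ x => by simp) (fun x hx => ?_) (fun _ => measurableSet_Ico) (fun _ => subset_rfl)
    (fun i j hij => (hij rfl).elim) (fun _ => ?_) (fun _ => ?_)
  · simp [abs_of_nonneg hx.1]
    linarith [hx.2]
  · simp [hI]
  · rw [setIntegral_congr_fun (g := fun x => x) measurableSet_Ico, hI]
    · norm_num
    · intro x hx
      simp [abs_of_nonneg hx.1]

/-! ### A localized kernel from Chebyshev polynomials. -/

theorem abs_sin_nat_mul_le (m : ℕ) (x : ℝ) : |Real.sin (m * x)| ≤ m * |Real.sin x| := by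
  induction m with
  | zero => simp
  | succ m ih =>
    have h1 : Real.sin ((m + 1 : ℕ) * x) =
        Real.sin (m * x) * Real.cos x + Real.cos (m * x) * Real.sin x := by
      rw [← Real.sin_add]; push_cast; ring_nf
    rw [h1]
    refine (abs_add_le _ _).trans ?_
    rw [abs_mul, abs_mul]
    have h2 : |Real.sin (m * x)| * |Real.cos x| ≤ m * |Real.sin x| * 1 :=
      mul_le_mul ih (Real.abs_cos_le_one x) (abs_nonneg _) (by positivity)
    have h3 : |Real.cos (m * x)| * |Real.sin x| ≤ 1 * |Real.sin x| :=
      mul_le_mul_of_nonneg_right (Real.abs_cos_le_one _) (abs_nonneg _)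
    push_cast
    linarith

/-- The index is 1 modulo 4, so shifting by `π/2` exchanges cosine for sine with a plus sign. -/
theorem chebyshev_T_eval_sin (q : ℕ) (α : ℝ) :
    (Polynomial.Chebyshev.T ℝ (4 * q + 1 : ℕ)).eval (Real.sin α) =
      Real.sin ((4 * q + 1 : ℕ) * α) := by
  rw [← Real.cos_pi_div_two_sub, Polynomial.Chebyshev.T_real_cos, ← Real.cos_pi_div_two_sub,
    ← Real.cos_add_nat_mul_two_pi (Real.pi / 2 - (4 * q + 1 : ℕ) * α) q]
  congr 1
  push_cast
  ring

/-- A nonnegative polynomial kernel of degree `8q`, of height `1` and width `1/(4q+1)`. -/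
theorem exists_polynomial_kernel (q : ℕ) :
    ∃ Q : Polynomial ℝ, Q.natDegree ≤ 8 * q ∧ ∀ u : ℝ, |u| ≤ 1 →
      0 ≤ Q.eval u ∧ Q.eval u ≤ 1 ∧ Q.eval u * ((4 * q + 1 : ℕ) * u) ^ 2 ≤ 1 ∧
      ((4 * q + 1 : ℕ) * |u| ≤ 1 → 2 / 5 ≤ Q.eval u) := by
  set m : ℕ := 4 * q + 1 with hm
  have hm0 : (0 : ℝ) < m := by positivity
  set T := Polynomial.Chebyshev.T ℝ (m : ℕ) with hT
  have hTsin : ∀ α, T.eval (Real.sin α) = Real.sin (m * α) := chebyshev_T_eval_sin q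
  have hT0 : T.coeff 0 = 0 := by
    rw [Polynomial.coeff_zero_eq_eval_zero]
    simpa using hTsin 0
  have hdiv : ∀ u, T.divX.eval u * u = T.eval u := by
    intro u
    have := congrArg (Polynomial.eval u) T.divX_mul_X_add
    simpa [hT0] using this
  -- The value of `T(u)/u` at 0 is `T'(0) = m * U_{m-1}(0) = m`.
  have hR0 : T.divX.eval 0 = m := by
    rw [← Polynomial.coeff_zero_eq_eval_zero, Polynomial.coeff_divX, zero_add]
    have h1 := congrArg (fun p => Polynomial.coeff p 0)
      (Polynomial.Chebyshev.T_derivative_eq_U (R := ℝ) (m : ℕ))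
    have h2 := Polynomial.Chebyshev.U_real_cos (Real.pi / 2) ((m : ℕ) - 1 : ℤ)
    have h3 : Real.sin ((((m : ℕ) - 1 : ℤ) + 1 : ℝ) * (Real.pi / 2)) = 1 := by
      rw [← Real.cos_pi_div_two_sub, ← Real.cos_add_nat_mul_two_pi _ q, Real.cos_eq_one_iff]
      refine ⟨0, ?_⟩
      rw [hm]; push_cast; ring
    rw [Real.cos_pi_div_two, Real.sin_pi_div_two, mul_one, h3] at h2
    simp only [Polynomial.coeff_zero_eq_eval_zero, Polynomial.eval_mul, h2] at h1
    rw [← Polynomial.coeff_zero_eq_eval_zero, Polynomial.coeff_derivative] at h1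
    simpa using h1
  have hbd : ∀ u, |u| ≤ 1 → T.divX.eval u ^ 2 ≤ m ^ 2 ∧ T.eval u ^ 2 ≤ 1 ∧
      (m * |u| ≤ 1 → 2 / 5 * (m : ℝ) ^ 2 ≤ T.divX.eval u ^ 2) := by
    intro u hu
    obtain ⟨hu1, hu2⟩ := abs_le.1 hu
    set α := Real.arcsin u with hα
    have hs : Real.sin α = u := Real.sin_arcsin hu1 hu2
    have hTu : T.eval u = Real.sin (m * α) := by rw [← hs, hTsin]
    refine ⟨?_, ?_, fun hmu => ?_⟩
    · rcases eq_or_ne u 0 with h0 | h0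
      · rw [h0, hR0]
      · have h1 : T.eval u ^ 2 ≤ (m * u) ^ 2 := by
          rw [sq_le_sq, abs_mul, abs_of_pos hm0, hTu, ← hs]
          exact abs_sin_nat_mul_le m α
        rw [← hdiv, mul_pow, mul_pow] at h1
        exact le_of_mul_le_mul_right h1 (by positivity)
    · rw [hTu]; exact Real.sin_sq_le_one _
    · rcases eq_or_ne u 0 with h0 | h0
      · rw [h0, hR0]; nlinarith
      -- Jordan's inequality is used twice: at `α`, to place `m α` within `π/2` of 0, then at `m α`,
      -- to bound the sine below. The constant is `4/π² ≥ 2/5`.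
      · have hπ : 0 < Real.pi := Real.pi_pos
        have h1 : 2 / Real.pi * |α| ≤ |u| := by
          rw [← hs]
          exact Real.mul_abs_le_abs_sin (abs_le.2 ⟨Real.neg_pi_div_two_le_arcsin u,
            Real.arcsin_le_pi_div_two u⟩)
        have h2 : |(m : ℝ) * α| ≤ Real.pi / 2 := by
          rw [abs_mul, abs_of_pos hm0]
          rw [div_mul_eq_mul_div, div_le_iff₀ hπ] at h1
          nlinarith
        have h3 := Real.mul_abs_le_abs_sin h2
        have h4 : |u| ≤ |α| := by rw [← hs]; exact Real.abs_sin_le_abs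
        have h5 : 2 / Real.pi * (m * |u|) ≤ |T.eval u| := by
          rw [hTu]
          refine le_trans ?_ h3
          rw [abs_mul, abs_of_pos hm0]
          gcongr
        have h6 : (2 / Real.pi * (m * |u|)) ^ 2 ≤ T.eval u ^ 2 := by
          rw [← sq_abs (T.eval u)]
          exact pow_le_pow_left₀ (by positivity) h5 2
        rw [← hdiv, mul_pow, mul_pow, mul_pow, sq_abs, ← mul_assoc] at h6
        have h7 := le_of_mul_le_mul_right h6 (by positivity)
        refine le_trans ?_ h7
        gcongr
        rw [div_pow, le_div_iff₀ (by positivity)]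
        nlinarith [Real.pi_lt_d2]
  refine ⟨Polynomial.C (1 / (m : ℝ) ^ 2) * T.divX ^ 2, ?_, fun u hu => ?_⟩
  · refine (Polynomial.natDegree_C_mul_le _ _).trans (Polynomial.natDegree_pow_le.trans ?_)
    rw [Polynomial.natDegree_divX_eq_natDegree_tsub_one, hT, Polynomial.Chebyshev.natDegree_T]
    simp only [Int.natAbs_natCast, hm]
    omega
  · obtain ⟨h1, h2, h3⟩ := hbd u hu
    simp only [Polynomial.eval_mul, Polynomial.eval_C, Polynomial.eval_pow]
    refine ⟨by positivity, ?_, ?_, fun h => ?_⟩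
    · rw [one_div, inv_mul_le_iff₀ (by positivity), mul_one]; exact h1
    · rw [← hdiv] at h2
      have : 1 / (m : ℝ) ^ 2 * T.divX.eval u ^ 2 * (m * u) ^ 2 = (T.divX.eval u * u) ^ 2 := by
        field_simp
      rw [this]; exact h2
    · rw [one_div, le_inv_mul_iff₀ (by positivity), mul_comm]; exact h3 h

/-! ### Inverse-square sums and the geometry of cells. -/

theorem sum_range_inv_sq_le (n : ℕ) : ∑ j ∈ Finset.range n, 1 / ((j : ℝ) + 1) ^ 2 ≤ 2 := by
  have h : ∀ n : ℕ, ∑ j ∈ Finset.range (n + 1), 1 / ((j : ℝ) + 1) ^ 2 ≤ 2 - 1 / ((n : ℝ) + 1) := by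
    intro n
    induction n with
    | zero => norm_num
    | succ n ih =>
      rw [Finset.sum_range_succ]
      have : 1 / (((n + 1 : ℕ) : ℝ) + 1) ^ 2 ≤
          1 / ((n : ℝ) + 1) - 1 / (((n + 1 : ℕ) : ℝ) + 1) := by
        push_cast
        rw [div_sub_div _ _ (by positivity) (by positivity),
          div_le_div_iff₀ (by positivity) (by positivity)]
        nlinarith [(Nat.cast_nonneg n : (0 : ℝ) ≤ n)]
      linarith
  cases n with
  | zero => norm_num
  | succ n => exact (h n).trans (by have : 0 ≤ 1 / ((n : ℝ) + 1) := by positivity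
                                    linarith)

theorem sum_erase_inv_sq_sub_le {k : ℕ} (i : Fin k) :
    ∑ l ∈ Finset.univ.erase i, 1 / (((i : ℕ) : ℝ) - (l : ℕ)) ^ 2 ≤ 4 := by
  have h1 : ∑ l ∈ Finset.univ.erase i, 1 / (((i : ℕ) : ℝ) - (l : ℕ)) ^ 2 =
      ∑ l ∈ Finset.range k, 1 / (((i : ℕ) : ℝ) - (l : ℕ)) ^ 2 := by
    rw [← Fin.sum_univ_eq_sum_range fun l => 1 / (((i : ℕ) : ℝ) - (l : ℕ)) ^ 2]
    -- The erased term is `1 / 0 = 0`, so restoring it changes nothing.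
    exact Finset.sum_erase _ (by simp)
  have h2 := Finset.sum_range_add_sum_Ico (fun l => 1 / (((i : ℕ) : ℝ) - (l : ℕ)) ^ 2) i.2.le
  have h3 : ∑ l ∈ Finset.range i, 1 / (((i : ℕ) : ℝ) - (l : ℕ)) ^ 2 ≤ 2 := by
    rw [← Finset.sum_range_reflect]
    refine le_trans (le_of_eq (Finset.sum_congr rfl fun j hj => ?_)) (sum_range_inv_sq_le i)
    have hj' : j + 1 ≤ (i : ℕ) := Finset.mem_range.1 hj
    rw [Nat.sub_sub, add_comm 1 j, Nat.cast_sub hj']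
    push_cast
    ring_nf
  have h4 : ∑ l ∈ Finset.Ico (i : ℕ) k, 1 / (((i : ℕ) : ℝ) - (l : ℕ)) ^ 2 ≤ 2 := by
    rw [Finset.sum_eq_sum_Ico_succ_bot i.2, sub_self, Finset.sum_Ico_eq_sum_range]
    refine le_trans (le_of_eq ?_) (sum_range_inv_sq_le (k - (i + 1)))
    rw [zero_pow two_ne_zero, div_zero, zero_add]
    refine Finset.sum_congr rfl fun j _ => ?_
    push_cast
    ring_nf
  linarith

theorem sum_inv_sq_add_le {k : ℕ} (i : Fin k) :
    ∑ l : Fin k, 1 / (((i : ℕ) : ℝ) + (l : ℕ) + 1) ^ 2 ≤ 2 := by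
  refine le_trans ?_ (sum_range_inv_sq_le k)
  rw [← Fin.sum_univ_eq_sum_range fun l => 1 / ((l : ℝ) + 1) ^ 2]
  gcongr with l
  linarith [(Nat.cast_nonneg (i : ℕ) : (0 : ℝ) ≤ (i : ℕ))]

/-- The decay profile of the odd kernels across cells. -/
noncomputable def cellDecay (i l : ℕ) : ℝ :=
  1 / ((i : ℝ) - l) ^ 2 + 1 / ((i : ℝ) + l + 1) ^ 2

theorem cellDecay_comm (i l : ℕ) : cellDecay i l = cellDecay l i := by
  unfold cellDecay
  rw [← neg_sub, neg_sq, add_comm (i : ℝ) l]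

theorem sum_erase_cellDecay_le {k : ℕ} (i : Fin k) :
    ∑ l ∈ Finset.univ.erase i, cellDecay i l ≤ 6 := by
  unfold cellDecay
  rw [Finset.sum_add_distrib]
  have h1 := sum_erase_inv_sq_sub_le i
  have h2 : ∑ l ∈ Finset.univ.erase i, 1 / (((i : ℕ) : ℝ) + (l : ℕ) + 1) ^ 2 ≤
      ∑ l : Fin k, 1 / (((i : ℕ) : ℝ) + (l : ℕ) + 1) ^ 2 :=
    Finset.sum_le_sum_of_subset_of_nonneg (Finset.subset_univ _) fun _ _ _ => by positivity
  linarith [sum_inv_sq_add_le i]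

theorem exists_mem_Ico_div {k : ℕ} {x : ℝ} (hx : x ∈ Ico (0 : ℝ) 1) (hk : 0 < k) :
    ∃ i : Fin k, x ∈ Ico ((i : ℕ) / k : ℝ) (((i : ℕ) + 1) / k) := by
  have hk' : (0 : ℝ) < k := by exact_mod_cast hk
  have h0 : 0 ≤ x * k := mul_nonneg hx.1 hk'.le
  refine ⟨⟨⌊x * k⌋₊, (Nat.floor_lt h0).2 (by nlinarith [hx.2])⟩, ?_, ?_⟩
  · rw [div_le_iff₀ hk']; exact Nat.floor_le h0
  · rw [lt_div_iff₀ hk']; exact Nat.lt_floor_add_one _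

/-- Closed cells are needed because reflecting `[-1,0]` reaches the endpoint 1, which goes to the
last cell. -/
theorem exists_mem_Icc_div {k : ℕ} {x : ℝ} (hx : x ∈ Icc (0 : ℝ) 1) (hk : 0 < k) :
    ∃ i : Fin k, x ∈ Icc ((i : ℕ) / k : ℝ) (((i : ℕ) + 1) / k) := by
  rcases hx.2.lt_or_eq with h | h
  · obtain ⟨i, hi⟩ := exists_mem_Ico_div ⟨hx.1, h⟩ hk
    exact ⟨i, Ico_subset_Icc_self hi⟩
  · have hk' : (0 : ℝ) < k := by exact_mod_cast hk
    refine ⟨⟨k - 1, by omega⟩, ?_⟩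
    rw [h]
    simp only [Nat.cast_sub hk, mem_Icc, div_le_iff₀ hk', le_div_iff₀ hk']
    constructor <;> simp

/-- The distance to the midpoint of another cell is at least `(|i - l| - 1/2) / k`, and `|i - l| ≥
1`. -/
theorem abs_sub_node_ge {k : ℕ} {i l : ℕ} (hil : i ≠ l) {x : ℝ} (hk : 0 < k)
    (hx : x ∈ Icc ((i : ℝ) / k) ((i + 1) / k)) :
    |(i : ℝ) - l| / (2 * k) ≤ |x - (2 * l + 1) / (2 * k)| := by
  have hk' : (0 : ℝ) < k := by exact_mod_cast hk
  obtain ⟨h1, h2⟩ := hx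
  rw [div_le_iff₀ hk'] at h1
  rw [le_div_iff₀ hk'] at h2
  have h3 : x - (2 * l + 1) / (2 * k) = (2 * (x * k) - (2 * l + 1)) / (2 * k) := by field_simp
  rw [h3, abs_div, abs_of_pos (by positivity : (0 : ℝ) < 2 * k)]
  refine div_le_div_of_nonneg_right ?_ (by positivity)
  rcases Nat.lt_or_gt_of_ne hil with h | h
  · have h' : (i : ℝ) + 1 ≤ l := by exact_mod_cast h
    rw [abs_of_nonpos (by linarith), abs_of_nonpos (by linarith)]
    linarith
  · have h' : (l : ℝ) + 1 ≤ i := by exact_mod_cast h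
    rw [abs_of_nonneg (by linarith), abs_of_nonneg (by linarith)]
    linarith

/-! ### Concentrated odd polynomials and their separated family. -/

/-- Odd polynomials of degree at most `280 k`, each concentrated on one of the `k` equal cells of
`[0,1)`. -/
theorem exists_odd_polynomials {k : ℕ} (hk : 0 < k) :
    ∃ p : Fin k → Polynomial ℝ, (∀ l, (p l).natDegree ≤ 280 * k) ∧
      (∀ l x, (p l).eval (-x) = -(p l).eval x) ∧
      (∀ i l : Fin k, i ≠ l → ∀ x ∈ Icc ((i : ℕ) / k : ℝ) (((i : ℕ) + 1) / k),
        |(p l).eval x| ≤ 1 / 1225 * cellDecay i l) ∧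
      (∀ (l : Fin k), ∀ x ∈ Icc (0 : ℝ) 1, |(p l).eval x| ≤ 1) ∧
      (∀ l : Fin k, ∀ x ∈ Icc ((l : ℕ) / k : ℝ) (((l : ℕ) + 1) / k),
        -(1 / 1225) ≤ (p l).eval x ∧
        (|x - (2 * (l : ℕ) + 1) / (2 * k)| ≤ 2 / (140 * k + 1) →
          2 / 5 - 1 / 1225 ≤ (p l).eval x)) := by
  have hk' : (0 : ℝ) < k := by exact_mod_cast hk
  -- With `m = 140 k + 1`, a point at distance `r / (2k)` from the node has `m u ≥ 35 r` after
  -- halving, hence the factor `1/1225`.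
  obtain ⟨Q, hQd, hQ⟩ := exists_polynomial_kernel (35 * k)
  have hm : ((4 * (35 * k) + 1 : ℕ) : ℝ) = 140 * k + 1 := by push_cast; ring
  rw [hm] at hQ
  have hdecay : ∀ v r : ℝ, |v| ≤ 2 → 0 < r → r / (2 * k) ≤ |v| →
      Q.eval (v / 2) ≤ 1 / 1225 * (1 / r ^ 2) := by
    intro v r hv hr hrv
    have hv2 : |v / 2| ≤ 1 := by rw [abs_div, abs_two]; linarith
    obtain ⟨h1, -, h2, -⟩ := hQ (v / 2) hv2
    have h3 : 35 * r ≤ |(140 * k + 1) * (v / 2)| := by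
      rw [abs_mul, abs_div, abs_two, abs_of_pos (by positivity : (0 : ℝ) < 140 * k + 1)]
      rw [div_le_iff₀ (by positivity)] at hrv
      nlinarith [abs_nonneg v]
    have h4 : (35 * r) ^ 2 ≤ ((140 * k + 1) * (v / 2)) ^ 2 := by
      rw [← sq_abs ((140 * k + 1) * (v / 2))]
      exact pow_le_pow_left₀ (by positivity) h3 2
    have h5 : Q.eval (v / 2) * (35 * r) ^ 2 ≤ 1 := (mul_le_mul_of_nonneg_left h4 h1).trans h2
    rw [show (1 / 1225 * (1 / r ^ 2) : ℝ) = 1 / (35 * r) ^ 2 by field_simp; norm_num,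
      le_div_iff₀ (by positivity)]
    exact h5
  let y : Fin k → ℝ := fun l => (2 * (l : ℕ) + 1) / (2 * k)
  have hy : ∀ l, 0 ≤ y l ∧ y l ≤ 1 := by
    intro l
    have : ((l : ℕ) : ℝ) + 1 ≤ k := by exact_mod_cast l.2
    refine ⟨by positivity, ?_⟩
    simp only [y]
    rw [div_le_one (by positivity)]
    linarith
  -- Halving keeps arguments in `[-1,1]`. Subtracting the mirror image makes `p l` odd; its bump
  -- sits at `-y l`, so on `[0,1]` only its tail is felt.
  let p : Fin k → Polynomial ℝ := fun l =>
    Q.comp (Polynomial.C (1 / 2) * Polynomial.X + Polynomial.C (-(y l / 2))) -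
    Q.comp (Polynomial.C (-(1 / 2)) * Polynomial.X + Polynomial.C (-(y l / 2)))
  have hp : ∀ l x, (p l).eval x = Q.eval ((x - y l) / 2) - Q.eval ((-x - y l) / 2) := by
    intro l x
    simp only [p, Polynomial.eval_sub, Polynomial.eval_comp, Polynomial.eval_add,
      Polynomial.eval_mul, Polynomial.eval_C, Polynomial.eval_X]
    congr 2 <;> ring
  have habs1 : ∀ l, ∀ x ∈ Icc (0 : ℝ) 1, |x - y l| ≤ 2 := fun l x hx =>
    abs_le.2 ⟨by linarith [hx.1, (hy l).2], by linarith [hx.2, (hy l).1]⟩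
  have habs2 : ∀ l, ∀ x ∈ Icc (0 : ℝ) 1, |-x - y l| ≤ 2 := fun l x hx =>
    abs_le.2 ⟨by linarith [hx.2, (hy l).2], by linarith [hx.1, (hy l).1]⟩
  have hhalf : ∀ v : ℝ, |v| ≤ 2 → |v / 2| ≤ 1 := fun v hv => by
    rw [abs_div, abs_two]; linarith
  have hcell : ∀ i : Fin k, Icc ((i : ℕ) / k : ℝ) (((i : ℕ) + 1) / k) ⊆ Icc (0 : ℝ) 1 := by
    intro i
    have : ((i : ℕ) : ℝ) + 1 ≤ k := by exact_mod_cast i.2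
    exact Icc_subset_Icc (by positivity) ((div_le_one hk').2 this)
  have hrefl : ∀ i l : Fin k, ∀ x ∈ Icc ((i : ℕ) / k : ℝ) (((i : ℕ) + 1) / k),
      Q.eval ((-x - y l) / 2) ≤ 1 / 1225 * (1 / (((i : ℕ) : ℝ) + (l : ℕ) + 1) ^ 2) := by
    intro i l x hx
    refine hdecay _ _ (habs2 l x (hcell i hx)) (by positivity) ?_
    rw [abs_of_nonpos (by linarith [(hcell i hx).1, (hy l).1])]
    have h1 := hx.1
    have h2 : (((i : ℕ) : ℝ) + (l : ℕ) + 1) / (2 * k) ≤ (i : ℕ) / k + y l := by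
      simp only [y]
      rw [div_add_div _ _ hk'.ne' (by positivity), div_le_div_iff₀ (by positivity) (by positivity)]
      have : (0 : ℝ) ≤ (i : ℕ) := by positivity
      have : (0 : ℝ) ≤ (l : ℕ) := by positivity
      nlinarith [mul_nonneg hk'.le (Nat.cast_nonneg (α := ℝ) (i : ℕ)),
        mul_nonneg hk'.le (Nat.cast_nonneg (α := ℝ) (l : ℕ)), mul_pos hk' hk',
        mul_nonneg (mul_pos hk' hk').le (Nat.cast_nonneg (α := ℝ) (i : ℕ)),
        mul_nonneg (mul_pos hk' hk').le (Nat.cast_nonneg (α := ℝ) (l : ℕ))]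
    linarith
  refine ⟨p, fun l => ?_, fun l x => ?_, fun i l hil x hx => ?_, fun l x hx => ?_,
    fun l x hx => ⟨?_, fun hxy => ?_⟩⟩
  · have hlin : ∀ a b : ℝ,
        (Q.comp (Polynomial.C a * Polynomial.X + Polynomial.C b)).natDegree ≤ 280 * k := by
      intro a b
      refine Polynomial.natDegree_comp_le.trans ?_
      calc _ ≤ 8 * (35 * k) * 1 := Nat.mul_le_mul hQd Polynomial.natDegree_linear_le
        _ = 280 * k := by ring
    exact (Polynomial.natDegree_sub_le _ _).trans (max_le (hlin _ _) (hlin _ _))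
  · rw [hp, hp, neg_neg]; ring
  · rw [hp]
    have hx' := hcell i hx
    have h1 := hdecay (x - y l) |((i : ℕ) : ℝ) - (l : ℕ)| (habs1 l x hx')
      (abs_pos.2 (sub_ne_zero.2 fun h => hil (Fin.ext (by exact_mod_cast h))))
      (abs_sub_node_ge (fun h => hil (Fin.ext h)) hk hx)
    have h2 := hrefl i l x hx
    have h3 := (hQ _ (hhalf _ (habs1 l x hx'))).1
    have h4 := (hQ _ (hhalf _ (habs2 l x hx'))).1
    rw [sq_abs] at h1
    unfold cellDecay
    rw [mul_add]
    have h5 : 0 ≤ 1 / 1225 * (1 / (((i : ℕ) : ℝ) - (l : ℕ)) ^ 2) := by positivity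
    have h6 : 0 ≤ 1 / 1225 * (1 / (((i : ℕ) : ℝ) + (l : ℕ) + 1) ^ 2) := by positivity
    exact abs_le.2 ⟨by linarith, by linarith⟩
  · rw [hp]
    obtain ⟨h1, h2, -⟩ := hQ _ (hhalf _ (habs1 l x hx))
    obtain ⟨h3, h4, -⟩ := hQ _ (hhalf _ (habs2 l x hx))
    exact abs_le.2 ⟨by linarith, by linarith⟩
  all_goals
    have hx' := hcell l hx
    have h1 := hrefl l l x hx
    have h2 : 1 / (((l : ℕ) : ℝ) + (l : ℕ) + 1) ^ 2 ≤ 1 := by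
      rw [div_le_one (by positivity)]
      refine one_le_pow₀ ?_
      linarith [(Nat.cast_nonneg (l : ℕ) : (0 : ℝ) ≤ (l : ℕ))]
    obtain ⟨h3, -, -, h4⟩ := hQ _ (hhalf _ (habs1 l x hx'))
    rw [hp]
  · linarith
  · have h5 := h4 (by
      rw [abs_div, abs_two]
      rw [le_div_iff₀ (by positivity)] at hxy
      change |x - y l| * _ ≤ 2 at hxy
      linarith)
    linarith

/-- All foreign cells together receive at most `6 / (1225 k)` of the mass of a bump, while its own
cell receives at least `(4/141 * 2/5 - 1/1225) / k`. The margin exceeds `1 / (200 k)`. -/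
theorem exists_separatedFamily_polynomial {k : ℕ} (hk : 0 < k) {d : ℕ} (hd : 280 * k ≤ d) :
    ∃ (φ : Fin k → ℝ → ℝ) (S : Fin k → Set ℝ),
      SeparatedFamily 1 d φ S (1 / (200 * k)) (4 / k) := by
  have hk' : (1 : ℝ) ≤ k := by exact_mod_cast hk
  have hk0 : (0 : ℝ) < k := by linarith
  obtain ⟨p, hdeg, hodd, hfar, hone, hnear⟩ := exists_odd_polynomials hk
  set S : Fin k → Set ℝ := fun i => Ico ((i : ℕ) / k : ℝ) (((i : ℕ) + 1) / k) with hS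
  have hSm : ∀ i, MeasurableSet (S i) := fun i => measurableSet_Ico
  have hSsub : ∀ i, S i ⊆ Ico (0 : ℝ) 1 := fun i => by
    have : ((i : ℕ) : ℝ) + 1 ≤ k := by exact_mod_cast i.2
    exact Ico_subset_Ico (by positivity) ((div_le_one hk0).2 this)
  have hvol : ∀ i, volume.real (S i) = 1 / k := by
    intro i
    rw [Real.volume_real_Ico, ← sub_div, add_sub_cancel_left, max_eq_left (by positivity)]
  have hfin : ∀ i, volume (S i) < ⊤ := fun i => by simp [hS]
  have hdisj : Pairwise fun i j => Disjoint (S i) (S j) := by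
    intro i j hij
    refine Set.disjoint_left.2 fun x hx hx' => hij ?_
    obtain ⟨h1, h2⟩ := hx
    obtain ⟨h3, h4⟩ := hx'
    have h5 : ((i : ℕ) : ℝ) < (j : ℕ) + 1 := (div_lt_div_iff_of_pos_right hk0).1 (h1.trans_lt h4)
    have h6 : ((j : ℕ) : ℝ) < (i : ℕ) + 1 := (div_lt_div_iff_of_pos_right hk0).1 (h3.trans_lt h2)
    have h7 : (i : ℕ) < j + 1 := by exact_mod_cast h5
    have h8 : (j : ℕ) < i + 1 := by exact_mod_cast h6
    exact Fin.ext (by omega)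
  have hint : ∀ i (l : Fin k), IntegrableOn (fun x => (p l).eval x) (S i) := fun i l =>
    ((p l).continuous.integrableOn_Icc (a := 0) (b := 1)).mono_set
      ((hSsub i).trans Ico_subset_Icc_self)
  have hcellbd : ∀ (i l : Fin k) (C : ℝ), (∀ x ∈ S i, |(p l).eval x| ≤ C) →
      ∫ x in S i, |(p l).eval x| ≤ C / k := by
    intro i l C hC
    have h1 := norm_setIntegral_le_of_norm_le_const (f := fun x => |(p l).eval x|) (hfin i)
      (fun x hx => by rw [Real.norm_eq_abs, abs_abs]; exact hC x hx)
    rw [hvol, mul_one_div] at h1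
    exact (le_abs_self _).trans h1
  have hoff : ∀ l : Fin k, ∑ i ∈ Finset.univ.erase l, ∫ x in S i, |(p l).eval x| ≤
      6 / 1225 / k := by
    intro l
    calc _ ≤ ∑ i ∈ Finset.univ.erase l, 1 / 1225 * cellDecay l i / k := by
          refine Finset.sum_le_sum fun i hi => hcellbd i l _ fun x hx => ?_
          rw [cellDecay_comm]
          exact hfar i l (Finset.ne_of_mem_erase hi) x (Ico_subset_Icc_self hx)
      _ = 1 / 1225 * (∑ i ∈ Finset.univ.erase l, cellDecay l i) / k := by
          rw [Finset.mul_sum, Finset.sum_div]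
      _ ≤ 1 / 1225 * 6 / k := by
          gcongr
          exact sum_erase_cellDecay_le l
      _ = 6 / 1225 / k := by norm_num
  refine ⟨_, S, separatedFamily_of_odd p S (fun i => (hdeg i).trans hd) hodd (fun x hx => ?_) hSm
    hSsub hdisj (fun l => ?_) fun l => ?_⟩
  · obtain ⟨i, hi⟩ := exists_mem_Icc_div hx hk
    rw [← Finset.add_sum_erase _ _ (Finset.mem_univ i)]
    have h1 : ∑ l ∈ Finset.univ.erase i, |(p l).eval x| ≤
        ∑ l ∈ Finset.univ.erase i, 1 / 1225 * cellDecay i l :=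
      Finset.sum_le_sum fun l hl => hfar i l (Finset.ne_of_mem_erase hl).symm x hi
    rw [← Finset.mul_sum] at h1
    linarith [hone i x hx, sum_erase_cellDecay_le i]
  -- The window on which the kernel is at least `2/5`; it fits inside the cell.
  · set W : Set ℝ := Icc ((2 * (l : ℕ) + 1) / (2 * k) - 2 / (140 * k + 1))
      ((2 * (l : ℕ) + 1) / (2 * k) + 2 / (140 * k + 1)) with hW
    have hw : 2 / (140 * (k : ℝ) + 1) < 1 / (2 * k) := by
      rw [div_lt_div_iff₀ (by positivity) (by positivity)]; linarith
    have hWS : W ⊆ S l := by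
      intro x hx
      have e1 : (2 * ((l : ℕ) : ℝ) + 1) / (2 * k) = (l : ℕ) / k + 1 / (2 * k) := by field_simp
      have e2 : (((l : ℕ) : ℝ) + 1) / k = (l : ℕ) / k + 1 / (2 * k) + 1 / (2 * k) := by
        field_simp; ring
      obtain ⟨h1, h2⟩ := hx
      rw [e1] at h1 h2
      exact ⟨by linarith, by rw [e2]; linarith⟩
    have hWm : MeasurableSet W := measurableSet_Icc
    have hWvol : volume.real W = 4 / (140 * k + 1) := by
      rw [hW, Real.volume_real_Icc, max_eq_left]
      · ring
      · have : 0 ≤ 2 / (140 * (k : ℝ) + 1) := by positivity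
        linarith
    have hWint : IntegrableOn (W.indicator fun _ => (2 / 5 : ℝ)) (S l) :=
      ((integrable_indicator_iff hWm).2 (integrableOn_const (by simp [hW]))).integrableOn
    have hcint : IntegrableOn (fun _ => (1 / 1225 : ℝ)) (S l) :=
      integrableOn_const (hfin l).ne
    have hlow : ∫ x in S l, (W.indicator (fun _ => (2 / 5 : ℝ)) x - 1 / 1225) ≤
        ∫ x in S l, (p l).eval x := by
      refine setIntegral_mono_on (hWint.sub hcint) (hint l l) (hSm l) fun x hx => ?_
      obtain ⟨h1, h2⟩ := hnear l x (Ico_subset_Icc_self hx)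
      by_cases hxW : x ∈ W
      · rw [indicator_of_mem hxW]
        exact h2 (abs_le.2 ⟨by linarith [hxW.1], by linarith [hxW.2]⟩)
      · rw [indicator_of_notMem hxW]
        linarith
    rw [integral_sub hWint hcint, setIntegral_indicator hWm, inter_eq_right.2 hWS,
      setIntegral_const, setIntegral_const, hWvol, hvol, smul_eq_mul, smul_eq_mul] at hlow
    have h1 : 4 / (141 * (k : ℝ)) ≤ 4 / (140 * k + 1) := by
      gcongr; linarith
    have h2 : 1 / (200 * (k : ℝ)) + 6 / 1225 / k ≤
        4 / (141 * (k : ℝ)) * (2 / 5) - 1 / k * (1 / 1225) := by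
      have e1 : 1 / (200 * (k : ℝ)) + 6 / 1225 / k = (1 / 200 + 6 / 1225) * (1 / k) := by
        field_simp
      have e2 : 4 / (141 * (k : ℝ)) * (2 / 5) - 1 / k * (1 / 1225) =
          (4 / 141 * (2 / 5) - 1 / 1225) * (1 / k) := by
        field_simp
      rw [e1, e2]
      gcongr
      norm_num
    linarith [hoff l]
  · have hU : Ico (0 : ℝ) 1 = ⋃ i, S i := by
      refine Subset.antisymm (fun x hx => ?_) (iUnion_subset hSsub)
      obtain ⟨i, hi⟩ := exists_mem_Ico_div hx hk
      exact mem_iUnion.2 ⟨i, hi⟩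
    rw [hU, integral_iUnion_fintype hSm hdisj fun i => (hint i l).abs,
      ← Finset.add_sum_erase _ _ (Finset.mem_univ l)]
    have h1 := hcellbd l l 1 fun x hx => hone l x (Ico_subset_Icc_self (hSsub l hx))
    have h2 := hoff l
    have h3 : 6 / 1225 / (k : ℝ) ≤ 1 / k := by gcongr; norm_num
    have h4 : 4 / (k : ℝ) = 2 * (1 / k + 1 / k) := by ring
    rw [h4]
    linarith

/-! ### Assembly over all degrees and the final constants. -/

/-- Piecewise polynomials support a separated family whose size is proportional to `t (d + 1)`. -/
theorem exists_separatedFamily {t d : ℕ} (ht : 1 ≤ t) (htd : 1 < t + d) :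
    ∃ (ι : Type) (_ : Fintype ι) (_ : DecidableEq ι) (φ : ι → ℝ → ℝ) (S : ι → Set ℝ) (β γ : ℝ),
      SeparatedFamily t d φ S β γ ∧ 0 < Fintype.card ι ∧
      t * (d + 1) ≤ 560 * Fintype.card ι ∧ 0 ≤ β ∧ 1 / 200 ≤ β * Fintype.card ι ∧
      γ * Fintype.card ι ≤ 4 := by
  have ht' : (0 : ℝ) < t := by exact_mod_cast ht
  rcases Nat.eq_zero_or_pos d with rfl | hd
  -- In degree 0 each step uses two pieces; `1 < t + d` provides at least one pair.
  · have hs : 0 < t / 2 := by omega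
    have hs' : (0 : ℝ) < (t / 2 : ℕ) := by exact_mod_cast hs
    refine ⟨Fin (t / 2) × Unit, inferInstance, inferInstance, _, _, _, _,
      (separatedFamily_step.replicate hs).mono (Nat.div_mul_le_self t 2), ?_, ?_, by positivity, ?_,
      ?_⟩ <;> simp only [Fintype.card_prod, Fintype.card_fin, Fintype.card_unit, mul_one]
    · exact hs
    · omega
    · rw [div_mul_cancel₀ _ hs'.ne']; norm_num
    · rw [div_mul_cancel₀ _ hs'.ne']; norm_num
  · rcases Nat.lt_or_ge d 280 with hd' | hd'
    · have h := (separatedFamily_X hd).replicate ht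
      rw [mul_one] at h
      refine ⟨Fin t × Unit, inferInstance, inferInstance, _, _, _, _, h, ?_, ?_, by positivity, ?_,
        ?_⟩ <;> simp only [Fintype.card_prod, Fintype.card_fin, Fintype.card_unit, mul_one]
      · exact ht
      · nlinarith
      · rw [div_mul_cancel₀ _ ht'.ne']; norm_num
      · rw [div_mul_cancel₀ _ ht'.ne']; norm_num
    · have hk : 0 < d / 280 := by omega
      have hk' : (0 : ℝ) < (d / 280 : ℕ) := by exact_mod_cast hk
      obtain ⟨φ, S, h0⟩ := exists_separatedFamily_polynomial hk (d := d) (by omega)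
      have h := h0.replicate ht
      rw [mul_one] at h
      refine ⟨Fin t × Fin (d / 280), inferInstance, inferInstance, _, _, _, _, h, ?_, ?_,
        by positivity, ?_, ?_⟩ <;> simp only [Fintype.card_prod, Fintype.card_fin]
      · positivity
      · have : d + 1 ≤ 560 * (d / 280) := by omega
        nlinarith
      · push_cast
        field_simp
        norm_num
      · push_cast
        field_simp
        norm_num

theorem theorem3p2 :
    ∃ c : ℝ, 0 < c ∧ ∃ ε₀ : ℝ, 0 < ε₀ ∧
      ∀ t d : ℕ, 1 ≤ t → 1 < t + d →
      ∀ ε : ℝ, 0 < ε → ε ≤ ε₀ →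
      ∀ (n : ℕ) (L : LearningAlgorithm.{u} n), L.Learns t d ε →
        c * ((t : ℝ) * ((d : ℝ) + 1) / (1 + Real.log ((d : ℝ) + 1)) ^ 2 * (1 / ε ^ 2)) ≤ (n : ℝ) := by
  -- With `δ = 7000 ε`, `δ β K ≥ 35 ε > 32 ε`, and `ε ≤ 1/56000` is `δ ≤ 1/8`. The constant `10^13`
  -- dominates `560 * 2 * 32 * 7000² * 4`.
  refine ⟨1 / 10 ^ 13, by norm_num, 1 / 56000, by norm_num, fun t d ht htd ε hε hε' n L hL => ?_⟩
  obtain ⟨ι, _, _, φ, S, β, γ, h, hK, hcard, hβ, hβK, hγK⟩ := exists_separatedFamily ht htd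
  have hK' : (0 : ℝ) < Fintype.card ι := by exact_mod_cast hK
  have hcard' : (t : ℝ) * (d + 1) ≤ 560 * Fintype.card ι := by exact_mod_cast hcard
  have hn := h.half_lt_of_learns (δ := 7000 * ε) (by positivity) (by linarith) hβ hε.le
    (by nlinarith) L hL
  set K : ℝ := (Fintype.card ι : ℝ) with hKdef
  have h1 : K ≤ 2 * 32 * 7000 ^ 2 * 4 * (n * ε ^ 2) := by
    have h2 : (n : ℝ) * ε ^ 2 * (γ * K) ≤ n * ε ^ 2 * 4 := by gcongr
    have h3 := mul_lt_mul_of_pos_right hn hK'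
    nlinarith
  have hlog : 1 ≤ (1 + Real.log ((d : ℝ) + 1)) ^ 2 := by
    refine one_le_pow₀ ?_
    have := Real.log_nonneg (by linarith [(Nat.cast_nonneg d : (0 : ℝ) ≤ d)] : (1 : ℝ) ≤ d + 1)
    linarith
  have h4 : (t : ℝ) * ((d : ℝ) + 1) / (1 + Real.log ((d : ℝ) + 1)) ^ 2 ≤ t * (d + 1) :=
    div_le_self (by positivity) hlog
  calc _ ≤ 1 / 10 ^ 13 * ((t : ℝ) * (d + 1) * (1 / ε ^ 2)) := by gcongr
    _ = 1 / 10 ^ 13 * (t * (d + 1)) / ε ^ 2 := by ring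
    _ ≤ n := by
      rw [div_le_iff₀ (by positivity)]
      have : 0 ≤ (n : ℝ) * ε ^ 2 := by positivity
      linarith
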